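/- **Conventions.** A connected graph is viewed as a geodesic metric space with edges of length one; it is recorded by its vertex set with the path metric $d$, and geodesic rays are edge paths, $r:\mathbb N\to V$ with $d(r(m),r(n))=|m-n|$. For vertices $x,y,p$ put $(x.y)_p=\frac12(d(p,x)+d(p,y)-d(x,y))$. The graph is *hyperbolic* if for some $\delta$ all its geodesic triangles are $\delta$-thin: points on the sides $[x,y]$ and $[x,z]$ at the same distance $t\le (y.z)_x$ from $x$ are at distance at most $\delta$. The boundary $\partial X$ of a hyperbolic graph $X$ is the set of classes $[r]$ of geodesic rays, with $r\sim s$ if $\sup_n d(r(n),s(n))<\infty$. A sequence of vertices $u_m$ converges to $[r]$ if $(u_m.r(n))_p\to\infty$ as $m,n\to\infty$. For $\xi,\eta\in\partial X$ let $(\xi.\eta)_p=\sup\liminf_{m,n}(u_m.v_n)_p\in[0,\infty]$, the supremum over all sequences $u_m\to\xi$, $v_n\to\eta$. A metric $d_V$ on $\partial X$ is *visual* if there are a vertex $p$, a parameter $a>1$ and constants $k_1,k_2>0$ with $k_1a^{-(\xi.\eta)_p}\le d_V(\xi,\eta)\le k_2a^{-(\xi.\eta)_p}$ for all $\xi,\eta$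 (where $a^{-\infty}=0$). The limit set of a set $W$ of vertices is the set of all boundary points that are limits of sequences in $W$. A metric $d$ on a space $Z$ is *linearly connected* if there is a constant $K$ such that any $x,y\in Z$ are joined by a path of diameter at most $K\,d(x,y)$. Let $G$ be a group, $\mathbf P=(P_i)_{i\in I}$ a finite family of subgroups, and $S$ a finite generating set of $G$ such that $S\cap P_i$ generates $P_i$ for each $i$. The *cusped space* $X(G,\mathbf P,S)$ is the Cayley graph of $G$ with respect to $S$ together with a combinatorial horoball for each $i$ and each left coset $tP_i$: it has vertices $(v,k)$, $v\in tP_i$, $k\ge 0$, where $(v,0)$ is identified with $v$, an edge from $(v,k)$ to $(v,k+1)$ for $k\ge0$, and for $k>0$ an edge from $(v,k)$ to $(w,k)$ whenever $0<d_{tP_i}(v,w)\le 2^k$, where $d_{tP_i}$ is the path metric of the full subgraph of the Cayley graph on $tP_i$. The pair $(G,\mathbf P)$ is *relatively hyperbolic* if $X(G,\mathbf P,S)$ is hyperbolic for some such $S$. **Theorem.** Let $(G,\mathbf P)$ be relatively hyperbolic, let $A\le G$ be a subgroup, and let $(A,\mathbf Q)$, $\mathbf Q=(Q_j)_{j\in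 J}$, be relatively hyperbolic. Let $X=X(G,\mathbf P,S)$ and $Y=X(A,\mathbf Q,T)$ be any cusped spaces for these pairs, let $d_V$ be a visual metric on $\partial X$ and $d_1$ a visual metric on $\partial Y$ (the base points and parameters of $d_1$ and $d_V$ may differ), and suppose that $d_1$ is linearly connected. Suppose that each $Q_j$ is contained in some $P_{f(j)}$, and let $\iota:Y\to X$ be the map of vertices induced by the inclusion $A\le G$: it sends $a\in A$ to $a\in G$, and the vertex $(a,k)$ of the horoball of $aQ_j$ to the vertex $(a,k)$ of the horoball of $aP_{f(j)}$. If $\iota$ is a quasi-isometric embedding, i.e. there are $L\ge1$, $C\ge0$ with $\frac1Ld(x,y)-C\le d(\iota x,\iota y)\le L\,d(x,y)+C$ for all $x,y$, then the limit set of $\iota(Y)$ in $\partial X$ is linearly connected with respect to (the restriction of) $d_V$. -/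

import Mathlib

open Filter Topology
open scoped ENNReal

/-!
A connected graph `Γ` is regarded as a geodesic metric space in which every edge has length one.
It is recorded by its vertex set with the path metric `Γ.dist`; geodesic rays are edge paths.
-/

namespace HypGraph

/-- The inner (Gromov) product `(x.y)_p = (d(p,x) + d(p,y) - d(x,y)) / 2` of vertices. -/
noncomputable def gromovProduct {V : Type*} (Γ : SimpleGraph V) (p x y : V) : ℝ :=
  ((Γ.dist p x : ℝ) + (Γ.dist p y : ℝ) - (Γ.dist x y : ℝ)) / 2

/-- Hyperbolicity by thin triangles. In a connected graph, `v` lies on a geodesic from `x` to `y`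
exactly when `d(x,v) + d(v,y) = d(x,y)`. The condition says: if `v` on a side `[x,y]` and `w` on a
side `[x,z]` of a geodesic triangle have the same distance from `x`, and this distance is at most
`(y.z)_x` (that is, `v` and `w` have the same image in the comparison tripod), then
`d(v,w) ≤ δ`. -/
def IsHyperbolic {V : Type*} (Γ : SimpleGraph V) : Prop :=
  Γ.Connected ∧ ∃ δ : ℝ, ∀ x y z v w : V,
    Γ.dist x v + Γ.dist v y = Γ.dist x y →
    Γ.dist x w + Γ.dist w z = Γ.dist x z →
    Γ.dist x v = Γ.dist x w →
    (Γ.dist x v : ℝ) ≤ gromovProduct Γ x y z →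
    (Γ.dist v w : ℝ) ≤ δ

/-- A geodesic ray, given by its sequence of vertices. -/
structure GeodesicRay {V : Type*} (Γ : SimpleGraph V) where
  toFun : ℕ → V
  dist_eq : ∀ m n : ℕ, m ≤ n → Γ.dist (toFun m) (toFun n) = n - m

/-- Two rays are equivalent if `d(r(n), s(n)) ≤ K` for some `K` and all `n`. (The extended
distance `edist` is the distance in a connected graph.) -/
def raySetoid {V : Type*} (Γ : SimpleGraph V) : Setoid (GeodesicRay Γ) where
  r r s := ∃ K : ℕ, ∀ n : ℕ, Γ.edist (r.toFun n) (s.toFun n) ≤ (K : ℕ∞)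
  iseqv :=
    { refl := fun r => ⟨0, fun n => by simp⟩
      symm := by
        rintro r s ⟨K, hK⟩
        exact ⟨K, fun n => by rw [SimpleGraph.edist_comm]; exact hK n⟩
      trans := by
        rintro r s t ⟨K, hK⟩ ⟨L, hL⟩
        refine ⟨K + L, fun n => ?_⟩
        push_cast
        exact (SimpleGraph.edist_triangle (v := s.toFun n)).trans
          (add_le_add (hK n) (hL n)) }

/-- The boundary `∂Γ`: equivalence classes of geodesic rays. -/
def Boundary {V : Type*} (Γ : SimpleGraph V) : Type _ := Quotient (raySetoid Γ)

/-- The boundary point `[r]` represented by a geodesic ray. -/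
def Boundary.mk {V : Type*} {Γ : SimpleGraph V} (r : GeodesicRay Γ) : Boundary Γ :=
  Quotient.mk (raySetoid Γ) r

/-- The sequence of vertices `u` converges to the boundary point `ξ = [r]`:
`(u(m).r(n))_p → ∞` as `m, n → ∞`. -/
def ConvergesTo {V : Type*} (Γ : SimpleGraph V) (u : ℕ → V) (ξ : Boundary Γ) : Prop :=
  ∃ r : GeodesicRay Γ, Boundary.mk r = ξ ∧
    ∀ p : V, Tendsto (fun n : ℕ × ℕ => gromovProduct Γ p (u n.1) (r.toFun n.2)) atTop atTop

/-- The inner product of boundary points, with values in `[0, ∞]`: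
`(ξ.η)_p = sup liminf_{m,n → ∞} (u(m).v(n))_p`, over all sequences `u → ξ` and `v → η`. -/
noncomputable def boundaryProduct {V : Type*} (Γ : SimpleGraph V) (p : V)
    (ξ η : Boundary Γ) : ℝ≥0∞ :=
  ⨆ (u : ℕ → V) (v : ℕ → V) (_ : ConvergesTo Γ u ξ) (_ : ConvergesTo Γ v η),
    liminf (fun n : ℕ × ℕ => ENNReal.ofReal (gromovProduct Γ p (u n.1) (v n.2))) atTop

open Classical in
/-- `a ^ (-t)` for `t ∈ [0, ∞]`, with `a ^ (-∞) = 0` (used for `a > 1`). -/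
noncomputable def powNeg (a : ℝ) (t : ℝ≥0∞) : ℝ :=
  if t = ∞ then 0 else a ^ (-t.toReal)

/-- The metric `d` on `∂Γ` is visual: for some base point `p` and some parameter `a > 1`,
`k₁ a^{-(ξ.η)_p} ≤ d(ξ,η) ≤ k₂ a^{-(ξ.η)_p}` for all `ξ, η` and some constants `k₁, k₂ > 0`. -/
def IsVisualMetric {V : Type*} (Γ : SimpleGraph V) (d : MetricSpace (Boundary Γ)) : Prop :=
  ∃ (p : V) (a k₁ k₂ : ℝ), 1 < a ∧ 0 < k₁ ∧ 0 < k₂ ∧ ∀ ξ η : Boundary Γ,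
    k₁ * powNeg a (boundaryProduct Γ p ξ η) ≤ d.dist ξ η ∧
      d.dist ξ η ≤ k₂ * powNeg a (boundaryProduct Γ p ξ η)

/-- The limit set in `∂Γ` of a set `W` of vertices: all limits of sequences in `W`. -/
def limitSet {V : Type*} (Γ : SimpleGraph V) (W : Set V) : Set (Boundary Γ) :=
  {ξ | ∃ u : ℕ → V, (∀ n, u n ∈ W) ∧ ConvergesTo Γ u ξ}

/-- Quasi-isometric embeddings, that is, quasi-isometries onto the image. -/
def IsQuasiIsometricEmbedding {V W : Type*} (Γ : SimpleGraph V) (Λ : SimpleGraph W)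
    (φ : V → W) : Prop :=
  ∃ L C : ℝ, 1 ≤ L ∧ 0 ≤ C ∧ ∀ x y : V,
    (Γ.dist x y : ℝ) / L - C ≤ (Λ.dist (φ x) (φ y) : ℝ) ∧
      (Λ.dist (φ x) (φ y) : ℝ) ≤ L * (Γ.dist x y : ℝ) + C

end HypGraph

/-- A metric is linearly connected if, for some `K`, any two points `x, y` are joined by a path
of diameter at most `K d(x,y)`. -/
def LinearlyConnected (Z : Type*) [MetricSpace Z] : Prop :=
  ∃ K : ℝ, ∀ x y : Z, ∃ γ : Path x y, Metric.diam (Set.range γ) ≤ K * dist x y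

/-- The vertices of a cusped space: the elements `g` of `G` (depth zero), and for every index `i`
and every `g` the vertices over `g` of the horoball based on the coset `g P_i`;
`horo i g k` has depth `k + 1`. -/
inductive CuspVertex (G ι : Type*) where
  | base (g : G) : CuspVertex G ι
  | horo (i : ι) (g : G) (k : ℕ) : CuspVertex G ι

/-- The disjoint union, over the left cosets `tH`, of the full subgraphs of the Cayley graph of
`G` with respect to `S` that are spanned by `tH` (see `cosetGraph_adj`). -/
def cosetGraph {G : Type*} [Group G] (S : Set G) (H : Subgroup G) : SimpleGraph G :=
  SimpleGraph.mulCayley (S ∩ (H : Set G))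

theorem cosetGraph_adj {G : Type*} [Group G] (S : Set G) (H : Subgroup G) (g h : G) :
    (cosetGraph S H).Adj g h ↔ (SimpleGraph.mulCayley S).Adj g h ∧ g⁻¹ * h ∈ H := by
  unfold cosetGraph
  rw [SimpleGraph.mulCayley_adj', SimpleGraph.mulCayley_adj']
  constructor
  · rintro ⟨hne, s, ⟨hs, hsH⟩, h1 | h1⟩
    · refine ⟨⟨hne, s, hs, Or.inl h1⟩, ?_⟩
      subst h1
      simpa using hsH
    · refine ⟨⟨hne, s, hs, Or.inr h1⟩, ?_⟩
      subst h1
      simpa using hsH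
  · rintro ⟨⟨hne, s, hs, h1 | h1⟩, hH⟩
    · subst h1
      exact ⟨hne, s, ⟨hs, by simpa using hH⟩, Or.inl rfl⟩
    · subst h1
      exact ⟨hne, s, ⟨hs, by simpa using hH⟩, Or.inr rfl⟩

/-- The edges of the cusped space, each in one direction. Two vertices of the same depth `k > 0`
of a horoball are joined when their distance in the graph on which the horoball is based is
positive and at most `2 ^ k`; the extended distance is `⊤` for different cosets. -/
inductive CuspEdge {G ι : Type*} [Group G] (P : ι → Subgroup G) (S : Set G) :
    CuspVertex G ι → CuspVertex G ι → Prop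
  | cayley (g h : G) : (SimpleGraph.mulCayley S).Adj g h → CuspEdge P S (.base g) (.base h)
  | horizontal (i : ι) (g h : G) (k : ℕ) : g ≠ h →
      (cosetGraph S (P i)).edist g h ≤ ((2 ^ (k + 1) : ℕ) : ℕ∞) →
      CuspEdge P S (.horo i g k) (.horo i h k)
  | verticalBase (i : ι) (g : G) : CuspEdge P S (.base g) (.horo i g 0)
  | vertical (i : ι) (g : G) (k : ℕ) : CuspEdge P S (.horo i g k) (.horo i g (k + 1))

/-- The cusped space `X(G, P, S)`. -/
def cuspedGraph {G ι : Type*} [Group G] (P : ι → Subgroup G) (S : Set G) :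
    SimpleGraph (CuspVertex G ι) :=
  SimpleGraph.fromRel (CuspEdge P S)

/-- `S` is a finite generating set of `G` that contains generators of each `P_i`. -/
structure IsCuspGeneratingSet {G ι : Type*} [Group G] (P : ι → Subgroup G) (S : Set G) : Prop where
  finite : S.Finite
  closure_eq : Subgroup.closure S = ⊤
  closure_inter_eq : ∀ i, Subgroup.closure (S ∩ (P i : Set G)) = P i

/-- `(G, P)` is relatively hyperbolic: `G` and the finitely many subgroups `P_i` are finitely
generated, and some cusped space of `(G, P)` is hyperbolic. -/
def IsRelativelyHyperbolic {G ι : Type*} [Group G] (P : ι → Subgroup G) : Prop :=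
  Finite ι ∧ ∃ S : Set G, IsCuspGeneratingSet P S ∧ HypGraph.IsHyperbolic (cuspedGraph P S)

/-- The map of cusped spaces induced by the inclusion `A ≤ G`, where the `j`-th peripheral
subgroup of `A` is contained in the `f j`-th peripheral subgroup of `G`: the vertex of depth `k`
over `a` in the horoball of `a Q_j` goes to the vertex of depth `k` over `a` in the horoball of
`a P_{f j}`. -/
def cuspedInclusion {G ι κ : Type*} [Group G] (A : Subgroup G) (f : κ → ι) :
    CuspVertex A κ → CuspVertex G ι
  | .base a => .base (a : G)
  | .horo j a k => .horo (f j) (a : G) k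

namespace HypGraph

/-! ### Inner products and geodesics in connected graphs -/

section Basic

variable {V : Type*} {Γ : SimpleGraph V}

/-! The map ι extends to a map F of boundaries whose range is the limit set of the image
(`exists_boundaryMap`). F is continuous and weakly quasisymmetric: d(ξ,η) ≤ K d(ξ,ζ) implies
d(Fξ,Fη) ≤ H d(Fξ,Fζ), with H depending on K only. A path from ξ to ζ of diameter at most K d(ξ,ζ)
is therefore carried into the ball of radius H d(Fξ,Fζ) about Fξ, so its image has diameter at most
2H d(Fξ,Fζ).

For visual metrics, weak quasisymmetry says that F coarsely preserves the order of the inner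
products (ξ.η)_p and (ξ.ζ)_p. An additive error is enough, so base points and parameters do not
matter. For vertices this is `gromovProduct_order`: a quasi-isometric embedding sends the centre of
a tripod near the centre of the image tripod, by stability of quasi-geodesics
(`quasiGeodesic_near_geodesic`). `le_boundaryProduct` and `eventually_le_of_lt_boundaryProduct`
carry estimates from vertices to boundary points.

Thin triangles are used once, to obtain the four point condition for one cusped space of G. It
passes to every other generating set, and to the domain of ι, by pulling back along quasi-isometric
embeddings. -/

theorem dist_triangle_real (hc : Γ.Connected) (x y z : V) :
    (Γ.dist x z : ℝ) ≤ Γ.dist x y + Γ.dist y z := by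
  exact_mod_cast hc.dist_triangle

theorem dist_comm_real (x y : V) : (Γ.dist x y : ℝ) = Γ.dist y x := by
  rw [SimpleGraph.dist_comm]

theorem gromovProduct_comm (p x y : V) : gromovProduct Γ p x y = gromovProduct Γ p y x := by
  unfold gromovProduct
  rw [dist_comm_real x y]
  ring

theorem gromovProduct_nonneg (hc : Γ.Connected) (p x y : V) : 0 ≤ gromovProduct Γ p x y := by
  unfold gromovProduct
  linarith [dist_triangle_real hc x p y, dist_comm_real (Γ := Γ) x p]

theorem gromovProduct_self_right (p x : V) : gromovProduct Γ p x x = Γ.dist p x := by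
  simp [gromovProduct]

theorem gromovProduct_base_left (p x : V) : gromovProduct Γ p p x = 0 := by
  simp [gromovProduct]

theorem gromovProduct_eq_zero {p x y : V} (h : Γ.dist x p + Γ.dist p y = Γ.dist x y) :
    gromovProduct Γ p x y = 0 := by
  unfold gromovProduct
  have : (Γ.dist x p : ℝ) + Γ.dist p y = Γ.dist x y := by exact_mod_cast h
  linarith [dist_comm_real (Γ := Γ) x p]

theorem gromovProduct_le_dist_left (hc : Γ.Connected) (p x y : V) :
    gromovProduct Γ p x y ≤ Γ.dist p x := by
  unfold gromovProduct
  linarith [dist_triangle_real hc p x y]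

theorem gromovProduct_le_dist_right (hc : Γ.Connected) (p x y : V) :
    gromovProduct Γ p x y ≤ Γ.dist p y := by
  rw [gromovProduct_comm]
  exact gromovProduct_le_dist_left hc p y x

theorem dist_sub_dist_le_gromovProduct (hc : Γ.Connected) (p x y : V) :
    (Γ.dist p x : ℝ) - Γ.dist x y ≤ gromovProduct Γ p x y := by
  unfold gromovProduct
  linarith [dist_triangle_real hc p y x, dist_comm_real (Γ := Γ) x y]

theorem gromovProduct_le_add_dist_base (hc : Γ.Connected) (p q x y : V) :
    gromovProduct Γ p x y ≤ gromovProduct Γ q x y + Γ.dist p q := by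
  unfold gromovProduct
  linarith [dist_triangle_real hc p q x, dist_triangle_real hc p q y]

theorem gromovProduct_le_add_dist_right (hc : Γ.Connected) (p x y z : V) :
    gromovProduct Γ p x y ≤ gromovProduct Γ p x z + Γ.dist y z := by
  unfold gromovProduct
  linarith [dist_triangle_real hc p z y, dist_triangle_real hc x y z,
    dist_comm_real (Γ := Γ) y z]

/-- The inner product based at `p` in terms of inner products based at `q`. -/
theorem gromovProduct_change_base (p q x y : V) :
    gromovProduct Γ p x y = Γ.dist p q - gromovProduct Γ q p x - gromovProduct Γ q p y
      + gromovProduct Γ q x y := by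
  unfold gromovProduct
  linarith [dist_comm_real (Γ := Γ) p q]

theorem dist_le_of_adj_succ (hc : Γ.Connected) (g : ℕ → V) (N : ℕ)
    (h : ∀ i < N, Γ.dist (g i) (g (i + 1)) ≤ 1) {i j : ℕ} (hij : i ≤ j) (hj : j ≤ N) :
    Γ.dist (g i) (g j) ≤ j - i := by
  induction j, hij using Nat.le_induction with
  | base => simp
  | succ k hk ih =>
    have h1 := hc.dist_triangle (u := g i) (v := g k) (w := g (k + 1))
    have h2 := ih (by omega)
    have h3 := h k (by omega)
    omega

/-- The pieces before `i`, between `i` and `j`, and after `j` have lengths at most `i`, `j - i` and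
`N - j`. These sum to `N`, so no bound has slack. -/
theorem dist_eq_of_adj_succ (hc : Γ.Connected) (g : ℕ → V) (N : ℕ)
    (h : ∀ i < N, Γ.dist (g i) (g (i + 1)) ≤ 1) (hN : Γ.dist (g 0) (g N) = N)
    {i j : ℕ} (hij : i ≤ j) (hj : j ≤ N) :
    Γ.dist (g i) (g j) = j - i := by
  have h0 := dist_le_of_adj_succ hc g N h (Nat.zero_le i) (hij.trans hj)
  have h1 := dist_le_of_adj_succ hc g N h hij hj
  have h2 := dist_le_of_adj_succ hc g N h hj le_rfl
  have h3 := hc.dist_triangle (u := g 0) (v := g i) (w := g N)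
  have h4 := hc.dist_triangle (u := g i) (v := g j) (w := g N)
  omega

theorem exists_geodesic (hc : Γ.Connected) (x y : V) :
    ∃ g : ℕ → V, g 0 = x ∧ g (Γ.dist x y) = y ∧
      ∀ i j, i ≤ j → j ≤ Γ.dist x y → Γ.dist (g i) (g j) = j - i := by
  obtain ⟨w, hw⟩ := hc.exists_walk_length_eq_dist x y
  have hend : w.getVert (Γ.dist x y) = y := by rw [← hw]; exact w.getVert_length
  refine ⟨w.getVert, w.getVert_zero, hend, fun i j hij hj => ?_⟩
  refine dist_eq_of_adj_succ hc _ _ (fun i hi => ?_) ?_ hij hj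
  · exact (SimpleGraph.dist_eq_one_iff_adj.2 (w.adj_getVert_succ (hw ▸ hi))).le
  · rw [hend, w.getVert_zero]

theorem exists_geodesic_through (hc : Γ.Connected) {x y q : V}
    (hq : Γ.dist x q + Γ.dist q y = Γ.dist x y) :
    ∃ g : ℕ → V, g 0 = x ∧ g (Γ.dist x q) = q ∧ g (Γ.dist x y) = y ∧
      ∀ i j, i ≤ j → j ≤ Γ.dist x y → Γ.dist (g i) (g j) = j - i := by
  obtain ⟨g₁, h1, h1', h1d⟩ := exists_geodesic hc x q
  obtain ⟨g₂, h2, h2', h2d⟩ := exists_geodesic hc q y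
  let g : ℕ → V := fun i => if i ≤ Γ.dist x q then g₁ i else g₂ (i - Γ.dist x q)
  have hg1 : ∀ i ≤ Γ.dist x q, g i = g₁ i := fun i hi => if_pos hi
  have hg2 : ∀ i, Γ.dist x q ≤ i → g i = g₂ (i - Γ.dist x q) := by
    intro i hi
    rcases hi.eq_or_lt with rfl | h
    · rw [hg1 _ le_rfl, h1', Nat.sub_self, h2]
    · exact if_neg (by omega)
  have hend : g (Γ.dist x y) = y := by
    rw [hg2 _ (by omega), ← hq, Nat.add_sub_cancel_left, h2']
  have h0 : g 0 = x := by rw [hg1 _ (Nat.zero_le _), h1]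
  refine ⟨g, h0, by rw [hg1 _ le_rfl, h1'], hend, fun i j hij hj => ?_⟩
  refine dist_eq_of_adj_succ hc g _ (fun i hi => ?_) (by rw [h0, hend]) hij hj
  by_cases h : i + 1 ≤ Γ.dist x q
  · rw [hg1 i (by omega), hg1 _ h, h1d i (i + 1) (by omega) h]
    omega
  · rw [hg2 i (by omega), hg2 (i + 1) (by omega), h2d _ _ (by omega) (by omega)]
    omega

theorem exists_dist_eq (hc : Γ.Connected) (x y : V) {n : ℕ} (hn : n ≤ Γ.dist x y) :
    ∃ q : V, Γ.dist x q = n ∧ Γ.dist x q + Γ.dist q y = Γ.dist x y := by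
  obtain ⟨g, h0, h1, hg⟩ := exists_geodesic hc x y
  have h2 := hg 0 n (Nat.zero_le _) hn
  have h3 := hg n _ hn le_rfl
  rw [h0] at h2
  rw [h1] at h3
  exact ⟨g n, by omega, by omega⟩

end Basic

/-! ### The four point condition -/

section FourPoint

variable {V : Type*} {Γ : SimpleGraph V}

/-- The four point condition of Gromov. -/
def FourPoint (Γ : SimpleGraph V) (δ : ℝ) : Prop :=
  ∀ p x y z : V, min (gromovProduct Γ p x z) (gromovProduct Γ p z y) - δ ≤ gromovProduct Γ p x y

theorem FourPoint.nonneg (hc : Γ.Connected) {δ : ℝ} (h : FourPoint Γ δ) : 0 ≤ δ := by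
  obtain ⟨p⟩ := hc.nonempty
  have := h p p p p
  simp only [gromovProduct_base_left, min_self] at this
  linarith

theorem FourPoint.le {δ : ℝ} (h : FourPoint Γ δ) {p x y z : V} {t : ℝ}
    (h1 : t ≤ gromovProduct Γ p x z) (h2 : t ≤ gromovProduct Γ p z y) :
    t - δ ≤ gromovProduct Γ p x y :=
  le_trans (by linarith [le_min h1 h2]) (h p x y z)

/-- Slim triangles, expressed by inner products, imply the four point condition. -/
theorem fourPoint_of_slim (hc : Γ.Connected) {δ : ℝ} (h : ∀ x y z q : V,
    Γ.dist x q + Γ.dist q y = Γ.dist x y →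
      gromovProduct Γ q x z ≤ δ ∨ gromovProduct Γ q y z ≤ δ) :
    FourPoint Γ (3 * δ + 2) := by
  intro p x y z
  have hδ : 0 ≤ δ := by
    rcases h p p p p (by simp) with h | h <;> simpa [gromovProduct_base_left] using h
  -- Take the last vertex of `[x,y]` that is `δ`-close to `[x,p]` in the sense of products. Its
  -- successor must be close to `[y,p]`, which costs one more unit.
  obtain ⟨q, hq, hqx, hqy⟩ : ∃ q, Γ.dist x q + Γ.dist q y = Γ.dist x y ∧
      gromovProduct Γ q x p ≤ δ + 1 ∧ gromovProduct Γ q y p ≤ δ + 1 := by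
    obtain ⟨g, h0, h1, hg⟩ := exists_geodesic hc x y
    have hgeo : ∀ i ≤ Γ.dist x y,
        Γ.dist x (g i) + Γ.dist (g i) y = Γ.dist x y := by
      intro i hi
      have h2 := hg 0 i (Nat.zero_le _) hi
      have h3 := hg i _ hi le_rfl
      rw [h0] at h2
      rw [h1] at h3
      omega
    classical
    set m := Nat.findGreatest (fun i => gromovProduct Γ (g i) x p ≤ δ) (Γ.dist x y) with hm
    have hm1 : gromovProduct Γ (g m) x p ≤ δ :=
      Nat.findGreatest_spec (P := fun i => gromovProduct Γ (g i) x p ≤ δ) (Nat.zero_le _)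
        (by rw [h0, gromovProduct_base_left]; exact hδ)
    have hm2 : m ≤ Γ.dist x y := Nat.findGreatest_le _
    rcases hm2.eq_or_lt with he | hlt
    · refine ⟨g m, hgeo _ hm2, by linarith, ?_⟩
      rw [he, h1, gromovProduct_base_left]
      linarith
    · have h3 : ¬ gromovProduct Γ (g (m + 1)) x p ≤ δ :=
        Nat.findGreatest_is_greatest (P := fun i => gromovProduct Γ (g i) x p ≤ δ)
          (Nat.lt_succ_self m) hlt
      have h4 := (h x y p (g (m + 1)) (hgeo _ hlt)).resolve_left h3
      refine ⟨g m, hgeo _ hm2, by linarith, ?_⟩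
      have h5 := gromovProduct_le_add_dist_base hc (g m) (g (m + 1)) y p
      rw [hg m (m + 1) (by omega) hlt] at h5
      have : ((m + 1 - m : ℕ) : ℝ) = 1 := by simp
      linarith
  -- Now `(x.y)_p ≥ d(p,q) - 2δ - 2`, while slimness at `q` with third vertex `z` bounds `(x.z)_p`
  -- or `(z.y)_p` by `d(p,q) + δ`.
  have e := gromovProduct_change_base (Γ := Γ) p q x y
  rw [gromovProduct_eq_zero hq, gromovProduct_comm q p x, gromovProduct_comm q p y] at e
  rcases h x y z q hq with h1 | h1
  · have e1 := gromovProduct_change_base (Γ := Γ) p q x z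
    have := gromovProduct_nonneg hc q p x
    have := gromovProduct_nonneg hc q p z
    have := min_le_left (gromovProduct Γ p x z) (gromovProduct Γ p z y)
    linarith
  · have e1 := gromovProduct_change_base (Γ := Γ) p q z y
    rw [gromovProduct_comm q z y] at e1
    have := gromovProduct_nonneg hc q p y
    have := gromovProduct_nonneg hc q p z
    have := min_le_right (gromovProduct Γ p x z) (gromovProduct Γ p z y)
    linarith

/-- A point of `[x,y]` before the branch point of the tripod is `δ`-close to `[x,z]`; a later one
satisfies the same condition seen from `y`. -/
theorem IsHyperbolic.exists_fourPoint (h : IsHyperbolic Γ) : ∃ δ, FourPoint Γ δ := by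
  obtain ⟨hc, δ, hδ⟩ := h
  have key : ∀ x y z q : V, Γ.dist x q + Γ.dist q y = Γ.dist x y →
      (Γ.dist x q : ℝ) ≤ gromovProduct Γ x y z → gromovProduct Γ q x z ≤ δ := by
    intro x y z q hq hle
    have h1 : Γ.dist x q ≤ Γ.dist x z := by
      exact_mod_cast hle.trans (gromovProduct_le_dist_right hc x y z)
    obtain ⟨w, hw, hw'⟩ := exists_dist_eq hc x z h1
    have h2 := hδ x y z q w hq hw' hw.symm hle
    have h3 := gromovProduct_le_add_dist_base hc q w x z
    rw [gromovProduct_eq_zero hw'] at h3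
    linarith
  refine ⟨_, fourPoint_of_slim hc (δ := δ) fun x y z q hq => ?_⟩
  by_cases hle : (Γ.dist x q : ℝ) ≤ gromovProduct Γ x y z
  · exact Or.inl (key x y z q hq hle)
  · refine Or.inr (key y x z q ?_ ?_)
    · rw [SimpleGraph.dist_comm (u := y) (v := q), SimpleGraph.dist_comm (u := q) (v := x),
        SimpleGraph.dist_comm (u := y) (v := x)]
      omega
    · have hq' : (Γ.dist x q : ℝ) + Γ.dist q y = Γ.dist x y := by exact_mod_cast hq
      unfold gromovProduct at hle ⊢
      linarith [dist_comm_real (Γ := Γ) x y, dist_comm_real (Γ := Γ) q y,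
        dist_comm_real (Γ := Γ) y x]

/-- Two points near a geodesic at about the same distance from one end are close. -/
theorem FourPoint.dist_le (hc : Γ.Connected) {δ : ℝ} (h : FourPoint Γ δ) {x z v w : V} {D E : ℝ}
    (hv : gromovProduct Γ v x z ≤ D) (hw : gromovProduct Γ w x z ≤ D)
    (hE : |(Γ.dist x v : ℝ) - Γ.dist x w| ≤ E) : (Γ.dist v w : ℝ) ≤ 2 * D + 3 * E + 2 * δ := by
  have h1 := h x v w z
  have h2 := h.nonneg hc
  rw [abs_le] at hE
  have hz : gromovProduct Γ x v z ≥ Γ.dist x v - D := by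
    unfold gromovProduct at hv ⊢
    linarith [dist_comm_real (Γ := Γ) x v]
  have hz' : gromovProduct Γ x z w ≥ Γ.dist x w - D := by
    unfold gromovProduct at hw ⊢
    linarith [dist_comm_real (Γ := Γ) x w, dist_comm_real (Γ := Γ) w z]
  have h3 : Γ.dist x v - D - E ≤ min (gromovProduct Γ x v z) (gromovProduct Γ x z w) :=
    le_min (by linarith) (by linarith)
  unfold gromovProduct at h1 h3
  linarith

/-- Bisecting the chain costs one `δ` per halving, so the loss is only logarithmic in the number of
steps. The bound on `d(p, c a)` covers the empty chain. -/
theorem FourPoint.chain (hc : Γ.Connected) {δ : ℝ} (h : FourPoint Γ δ) (p : V) (c : ℕ → V) (t : ℝ)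
    (k : ℕ) : ∀ a b : ℕ, a ≤ b → b ≤ a + 2 ^ k → t ≤ Γ.dist p (c a) →
      (∀ i, a ≤ i → i < b → t ≤ gromovProduct Γ p (c i) (c (i + 1))) →
      t - k * δ ≤ gromovProduct Γ p (c a) (c b) := by
  have hδ := h.nonneg hc
  induction k with
  | zero =>
    intro a b hab hb ha hi
    rcases hab.eq_or_lt with rfl | hlt
    · rw [gromovProduct_self_right]
      simpa using ha
    · obtain rfl : b = a + 1 := by simp at hb; omega
      simpa using hi a le_rfl hlt
  | succ k ih =>
    intro a b hab hb ha hi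
    by_cases hb' : b ≤ a + 2 ^ k
    · have := ih a b hab hb' ha hi
      push_cast
      linarith
    · have h1 := ih a (a + 2 ^ k) (by omega) le_rfl ha fun i hi1 hi2 => hi i hi1 (by omega)
      have h2 := ih (a + 2 ^ k) b (by omega) (by rw [pow_succ] at hb; omega)
        ((hi _ (by omega) (by omega)).trans (gromovProduct_le_dist_left hc _ _ _))
        fun i hi1 hi2 => hi i (by omega) hi2
      have := h.le h1 h2
      push_cast
      linarith

end FourPoint

end HypGraph

namespace HypGraph

/-! ### Stability of quasi-geodesics -/

section Morse

variable {V : Type*} {Γ : SimpleGraph V}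

/-- `c` restricted to `{0, …, n}` is an `(L, C)`-quasi-geodesic. -/
def IsQuasiGeodesic (Γ : SimpleGraph V) (L C : ℝ) (c : ℕ → V) (n : ℕ) : Prop :=
  ∀ i j, i ≤ j → j ≤ n →
    ((j : ℝ) - i) / L - C ≤ Γ.dist (c i) (c j) ∧
      (Γ.dist (c i) (c j) : ℝ) ≤ L * ((j : ℝ) - i) + C

/-- This closes the stability argument, where the number of steps is exponential in `k` but is also
bounded linearly in `k`. -/
theorem exists_bound_of_two_pow_le_linear (A B : ℝ) :
    ∃ K : ℕ, ∀ k : ℕ, (2 : ℝ) ^ k ≤ A * k + B → k ≤ K := by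
  have h1 : Tendsto (fun n : ℕ => (n : ℝ) ^ 1 / (2 : ℝ) ^ n) atTop (𝓝 0) :=
    tendsto_pow_const_div_const_pow_of_one_lt 1 (by norm_num)
  have h0 : Tendsto (fun n : ℕ => (n : ℝ) ^ 0 / (2 : ℝ) ^ n) atTop (𝓝 0) :=
    tendsto_pow_const_div_const_pow_of_one_lt 0 (by norm_num)
  have h : Tendsto (fun n : ℕ => A * ((n : ℝ) ^ 1 / 2 ^ n) + B * ((n : ℝ) ^ 0 / 2 ^ n))
      atTop (𝓝 (A * 0 + B * 0)) := (h1.const_mul A).add (h0.const_mul B)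
  rw [mul_zero, mul_zero, add_zero] at h
  obtain ⟨K, hK⟩ := eventually_atTop.1 (h.eventually (gt_mem_nhds one_pos))
  refine ⟨K, fun k hk => ?_⟩
  by_contra! hlt
  have h2 := hK k hlt.le
  have h3 : (0 : ℝ) < 2 ^ k := by positivity
  rw [mul_div_assoc', mul_div_assoc', ← add_div, div_lt_one h3] at h2
  simp only [pow_one, pow_zero, mul_one] at h2
  linarith

/-- A geodesic lies in a bounded neighbourhood of a quasi-geodesic with the same ends. -/
theorem FourPoint.geodesic_near_quasiGeodesic (hc : Γ.Connected) {δ : ℝ} (h : FourPoint Γ δ)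
    {L C : ℝ} (hL : 1 ≤ L) (hC : 0 ≤ C) :
    ∃ D : ℝ, ∀ (c : ℕ → V) (n : ℕ), IsQuasiGeodesic Γ L C c n → ∀ p : V,
      Γ.dist (c 0) p + Γ.dist p (c n) = Γ.dist (c 0) (c n) →
      ∃ i ≤ n, (Γ.dist p (c i) : ℝ) ≤ D := by
  have hδ := h.nonneg hc
  obtain ⟨K, hK⟩ := exists_bound_of_two_pow_le_linear (2 * L * 6 * δ)
    (2 * (L * (6 * (L + C + 2 * δ) + C)) + 1)
  refine ⟨L + C + (K + 2) * δ, fun c n hq => ?_⟩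
  set N := Γ.dist (c 0) (c n) with hN
  have hex : ∃ D : ℕ, ∀ p, Γ.dist (c 0) p + Γ.dist p (c n) = N →
      ∃ i ≤ n, Γ.dist p (c i) ≤ D :=
    ⟨N, fun p hp => ⟨0, Nat.zero_le _, by rw [SimpleGraph.dist_comm]; omega⟩⟩
  classical
  -- `D` is the optimal integer bound; unless it is zero, minimality yields a vertex `p` of a
  -- geodesic at distance at least `D` from the whole quasi-geodesic.
  obtain ⟨D, hD, hmin⟩ : ∃ D : ℕ, (∀ p, Γ.dist (c 0) p + Γ.dist p (c n) = N →
      ∃ i ≤ n, Γ.dist p (c i) ≤ D) ∧ (D = 0 ∨ ∃ p, Γ.dist (c 0) p + Γ.dist p (c n) = N ∧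
      ∀ i ≤ n, D ≤ Γ.dist p (c i)) := by
    refine ⟨Nat.find hex, Nat.find_spec hex, ?_⟩
    rcases Nat.eq_zero_or_pos (Nat.find hex) with h0 | h0
    · exact Or.inl h0
    · right
      have := Nat.find_min hex (Nat.sub_lt h0 one_pos)
      push Not at this
      obtain ⟨p, hp, hp'⟩ := this
      exact ⟨p, hp, fun i hi => by have := hp' i hi; omega⟩
  suffices hbd : (D : ℝ) ≤ L + C + (K + 2) * δ by
    intro p hp
    obtain ⟨i, hi, hpi⟩ := hD p hp
    exact ⟨i, hi, le_trans (by exact_mod_cast hpi) hbd⟩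
  rcases hmin with h0 | ⟨p, hp, hfar⟩
  · rw [h0]
    push_cast
    positivity
  obtain ⟨g, hg0, hgp, hgN, hg⟩ := exists_geodesic_through hc hp
  rw [← hN] at hgN hg
  set d := Γ.dist (c 0) p with hd
  have hdN : d ≤ N := by omega
  have hgeo : ∀ i ≤ N, Γ.dist (c 0) (g i) + Γ.dist (g i) (c n) = N := by
    intro i hi
    have h2 := hg 0 i (Nat.zero_le _) hi
    have h3 := hg i _ hi le_rfl
    rw [hg0] at h2
    rw [hgN] at h3
    omega
  -- a point of the quasi-geodesic on each side, far from `p` along the geodesic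
  obtain ⟨a, x', han, hax, hpx, hDx, hx'⟩ : ∃ a x', a ≤ n ∧ Γ.dist x' (c a) ≤ D ∧
      Γ.dist p x' ≤ 2 * D ∧ (D : ℝ) ≤ gromovProduct Γ p x' (c a) ∧ x' = g (d - 2 * D) := by
    -- Subtraction is truncated: if `p` is within `2D` of the start, then `x'` is `c 0` itself.
    have hpd : Γ.dist p (g (d - 2 * D)) = d - (d - 2 * D) := by
      rw [SimpleGraph.dist_comm, ← hg (d - 2 * D) d (by omega) hdN, hgp]
    by_cases hle : d ≤ 2 * D
    · refine ⟨0, _, Nat.zero_le _, ?_, by omega, ?_, rfl⟩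
      · rw [Nat.sub_eq_zero_of_le hle, hg0]; simp
      · rw [Nat.sub_eq_zero_of_le hle, hg0, gromovProduct_self_right]
        exact_mod_cast hfar 0 (Nat.zero_le _)
    · obtain ⟨a, ha, hax⟩ := hD (g (d - 2 * D)) (hgeo _ (by omega))
      refine ⟨a, _, ha, hax, by omega, ?_, rfl⟩
      have h1 : (Γ.dist p (g (d - 2 * D)) : ℝ) = 2 * D := by
        rw [hpd]; exact_mod_cast (by omega : d - (d - 2 * D) = 2 * D)
      have h2 : (D : ℝ) ≤ Γ.dist p (c a) := by exact_mod_cast hfar a ha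
      have h3 : (Γ.dist (g (d - 2 * D)) (c a) : ℝ) ≤ D := by exact_mod_cast hax
      unfold gromovProduct
      linarith
  obtain ⟨b, y', hbn, hby, hpy, hDy, hy'⟩ : ∃ b y', b ≤ n ∧ Γ.dist y' (c b) ≤ D ∧
      Γ.dist p y' ≤ 2 * D ∧ (D : ℝ) ≤ gromovProduct Γ p y' (c b) ∧ y' = g (min (d + 2 * D) N) := by
    have hpd : Γ.dist p (g (min (d + 2 * D) N)) = min (d + 2 * D) N - d := by
      rw [← hg d _ (by omega) (by omega), hgp]
    by_cases hle : N ≤ d + 2 * D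
    · refine ⟨n, _, le_rfl, ?_, by omega, ?_, rfl⟩
      · rw [min_eq_right hle, hgN]; simp
      · rw [min_eq_right hle, hgN, gromovProduct_self_right]
        exact_mod_cast hfar n le_rfl
    · obtain ⟨a, ha, hax⟩ := hD (g (min (d + 2 * D) N)) (hgeo _ (by omega))
      refine ⟨a, _, ha, hax, by omega, ?_, rfl⟩
      have h1 : (Γ.dist p (g (min (d + 2 * D) N)) : ℝ) = 2 * D := by
        rw [hpd]; exact_mod_cast (by omega : min (d + 2 * D) N - d = 2 * D)
      have h2 : (D : ℝ) ≤ Γ.dist p (c a) := by exact_mod_cast hfar a ha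
      have h3 : (Γ.dist (g (min (d + 2 * D) N)) (c a) : ℝ) ≤ D := by exact_mod_cast hax
      unfold gromovProduct
      linarith
  have hxy : gromovProduct Γ p x' y' = 0 := by
    apply gromovProduct_eq_zero
    have h1 := hg (d - 2 * D) d (by omega) hdN
    have h2 := hg d (min (d + 2 * D) N) (by omega) (by omega)
    have h3 := hg (d - 2 * D) (min (d + 2 * D) N) (by omega) (by omega)
    rw [hgp] at h1 h2
    rw [hx', hy']
    omega
  have hab : (Γ.dist (c a) (c b) : ℝ) ≤ 6 * D := by
    have h1 := hc.dist_triangle (u := c a) (v := x') (w := c b)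
    have h2 := hc.dist_triangle (u := x') (v := p) (w := c b)
    have h3 := hc.dist_triangle (u := p) (v := y') (w := c b)
    rw [SimpleGraph.dist_comm (u := c a) (v := x')] at h1
    rw [SimpleGraph.dist_comm (u := x') (v := p)] at h2
    clear_value d N
    exact_mod_cast (by omega : Γ.dist (c a) (c b) ≤ 6 * D)
  -- the chain estimate along the quasi-geodesic
  have hstep : ∀ i, i < n → (D : ℝ) - (L + C) ≤ gromovProduct Γ p (c i) (c (i + 1)) := by
    intro i hi
    have h1 := (hq i (i + 1) (by omega) hi).2
    have h2 : (D : ℝ) ≤ Γ.dist p (c i) := by exact_mod_cast hfar i hi.le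
    have h3 := dist_sub_dist_le_gromovProduct hc p (c i) (c (i + 1))
    push_cast at h1
    linarith
  have hchain : ∀ a b : ℕ, a ≤ b → b ≤ n → (Γ.dist (c a) (c b) : ℝ) ≤ 6 * D →
      ∃ k : ℕ, (2 : ℝ) ^ k ≤ 2 * (L * (6 * D + C)) + 1 ∧
        (D : ℝ) - (L + C) - k * δ ≤ gromovProduct Γ p (c a) (c b) := by
    intro a b hab hb h6
    have hlen : ((b - a : ℕ) : ℝ) ≤ L * (6 * D + C) := by
      have h1 := (hq a b hab hb).1
      rw [Nat.cast_sub hab]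
      have : ((b : ℝ) - a) / L ≤ 6 * D + C := by linarith
      rwa [div_le_iff₀' (by linarith)] at this
    -- Rounding `b - a` up to a power of two at most doubles it, whence the factor 2; the summand 1
    -- covers `b - a ≤ 1`.
    refine ⟨Nat.clog 2 (b - a), ?_, ?_⟩
    · rcases Nat.lt_or_ge 1 (b - a) with h1 | h1
      · have h2 := Nat.pow_pred_clog_lt_self one_lt_two h1
        have h3 : 0 < Nat.clog 2 (b - a) := Nat.clog_pos one_lt_two h1
        have h4 : (2 : ℝ) ^ (Nat.clog 2 (b - a)).pred ≤ ((b - a : ℕ) : ℝ) := by exact_mod_cast h2.le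
        have h5 : (2 : ℝ) ^ Nat.clog 2 (b - a) = 2 * 2 ^ (Nat.clog 2 (b - a)).pred := by
          rw [← pow_succ', ← Nat.succ_eq_add_one, Nat.succ_pred_eq_of_pos h3]
        linarith
      · rw [Nat.clog_of_right_le_one h1]
        have : (0 : ℝ) ≤ L * (6 * D + C) := by positivity
        linarith [pow_zero (2 : ℝ)]
    · refine h.chain hc p c _ _ a b hab ?_ ?_ fun i _ hi => hstep i (by omega)
      · have := Nat.le_pow_clog one_lt_two (b - a)
        omega
      · have : (D : ℝ) ≤ Γ.dist p (c a) := by exact_mod_cast hfar a (by omega)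
        linarith
  obtain ⟨k, hk, hkab⟩ : ∃ k : ℕ, (2 : ℝ) ^ k ≤ 2 * (L * (6 * D + C)) + 1 ∧
        (D : ℝ) - (L + C) - k * δ ≤ gromovProduct Γ p (c a) (c b) := by
    rcases le_total a b with hle | hle
    · exact hchain a b hle hbn hab
    · rw [dist_comm_real] at hab
      rw [gromovProduct_comm]
      exact hchain b a hle han hab
  have hkδ : 0 ≤ (k : ℝ) * δ := by positivity
  -- Since `p` lies between `x'` and `y'`, `(x'.y')_p = 0`. The route `x'`, `c a`, `c b`, `y'`
  -- bounds this product below, with two more applications of the four point condition.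
  have hDk : (D : ℝ) ≤ L + C + (k + 2) * δ := by
    have h1 : (D : ℝ) - (L + C) - k * δ - δ ≤ gromovProduct Γ p x' (c b) :=
      h.le (z := c a) (by linarith) hkab
    rw [gromovProduct_comm] at hDy
    have h2 := h.le (t := (D : ℝ) - (L + C) - k * δ - δ) (z := c b) (y := y') h1 (by linarith)
    linarith
  -- Substituting the bound on `D` into `hk` leaves a linear bound on `2 ^ k`.
  have hkK : k ≤ K := by
    apply hK
    have : L * D ≤ L * (L + C + (k + 2) * δ) := by gcongr
    nlinarith
  have : (k : ℝ) * δ ≤ K * δ := by gcongr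
  linarith

/-- Stability of quasi-geodesics: a quasi-geodesic stays close to the geodesics joining its
ends. -/
theorem FourPoint.quasiGeodesic_near_geodesic (hc : Γ.Connected) {δ : ℝ} (h : FourPoint Γ δ)
    {L C : ℝ} (hL : 1 ≤ L) (hC : 0 ≤ C) :
    ∃ D : ℝ, ∀ (c : ℕ → V) (n : ℕ), IsQuasiGeodesic Γ L C c n → ∀ i ≤ n,
      gromovProduct Γ (c i) (c 0) (c n) ≤ D := by
  obtain ⟨D, hD⟩ := h.geodesic_near_quasiGeodesic hc hL hC
  refine ⟨L * (L * (2 * D + 1 + C)) + C + D, fun c n hq i hi => ?_⟩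
  obtain ⟨g, hg0, hgN, hg⟩ := exists_geodesic hc (c 0) (c n)
  set N := Γ.dist (c 0) (c n) with hN
  have hgeo : ∀ i ≤ N, Γ.dist (c 0) (g i) + Γ.dist (g i) (c n) = N := by
    intro i hi
    have h2 := hg 0 i (Nat.zero_le _) hi
    have h3 := hg i _ hi le_rfl
    rw [hg0] at h2
    rw [hgN] at h3
    omega
  have hD0 : 0 ≤ D := by
    obtain ⟨j, -, hj⟩ := hD c n hq (c 0) (by simp)
    exact le_trans (by positivity) hj
  -- A discrete connectedness argument: the last geodesic vertex near `c 0, …, c i` is followed by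
  -- one near a later part. So `c j` and `c k` are close with `j ≤ i ≤ k`, which bounds `k - j` and
  -- hence `d(c i, c j)`.
  have key : ∃ t ≤ N, ∃ j ≤ i, ∃ k ≤ n, i ≤ k ∧ (Γ.dist (g t) (c j) : ℝ) ≤ D ∧
      (Γ.dist (g t) (c k) : ℝ) ≤ D + 1 := by
    classical
    set m := Nat.findGreatest (fun t => ∃ j ≤ i, (Γ.dist (g t) (c j) : ℝ) ≤ D) N with hm
    have hmN : m ≤ N := Nat.findGreatest_le _
    obtain ⟨j, hj, hmj⟩ : ∃ j ≤ i, (Γ.dist (g m) (c j) : ℝ) ≤ D :=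
      Nat.findGreatest_spec (P := fun t => ∃ j ≤ i, (Γ.dist (g t) (c j) : ℝ) ≤ D)
        (Nat.zero_le _) ⟨0, Nat.zero_le _, by rw [hg0]; simpa using hD0⟩
    refine ⟨m, hmN, j, hj, ?_⟩
    rcases hmN.eq_or_lt with he | hlt
    · refine ⟨n, le_rfl, hi, hmj, ?_⟩
      rw [he, hgN, SimpleGraph.dist_self]
      push_cast
      linarith
    · have h1 := Nat.findGreatest_is_greatest
        (P := fun t => ∃ j ≤ i, (Γ.dist (g t) (c j) : ℝ) ≤ D) (Nat.lt_succ_self m) hlt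
      obtain ⟨k, hkn, hk⟩ := hD c n hq (g (m + 1)) (hgeo _ hlt)
      refine ⟨k, hkn, ?_, hmj, ?_⟩
      · by_contra! hlt'
        exact h1 ⟨k, hlt'.le, hk⟩
      · have h2 := dist_triangle_real hc (g m) (g (m + 1)) (c k)
        rw [hg m (m + 1) (by omega) hlt] at h2
        have : ((m + 1 - m : ℕ) : ℝ) = 1 := by simp
        linarith
  obtain ⟨t, ht, j, hji, k, hkn, hik, h1, h2⟩ := key
  have h3 := dist_triangle_real hc (c j) (g t) (c k)
  rw [dist_comm_real (c j) (g t)] at h3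
  have h4 := (hq j k (by omega) hkn).1
  have h5 := (hq j i hji hi).2
  have h6 : ((k : ℝ) - j) / L ≤ 2 * D + 1 + C := by linarith
  rw [div_le_iff₀' (by linarith)] at h6
  have h7 : (i : ℝ) ≤ k := by exact_mod_cast hik
  have h8 : L * ((i : ℝ) - j) ≤ L * (L * (2 * D + 1 + C)) := by
    gcongr
    linarith
  have h9 := dist_triangle_real hc (c i) (c j) (g t)
  rw [dist_comm_real (c i) (c j), dist_comm_real (c j) (g t)] at h9
  have h10 := gromovProduct_le_add_dist_base hc (c i) (g t) (c 0) (c n)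
  rw [gromovProduct_eq_zero (hgeo t ht)] at h10
  linarith

end Morse
end HypGraph

namespace HypGraph

/-! ### Quasi-isometric embeddings into hyperbolic graphs -/

section QuasiIsometry

variable {V W : Type*} {Γ : SimpleGraph V} {Λ : SimpleGraph W} {φ : V → W}

theorem IsQuasiIsometricEmbedding.gromovProduct_le_of_geodesic (hΓ : Γ.Connected)
    (hΛ : Λ.Connected) {δ : ℝ} (h : FourPoint Λ δ) (hφ : IsQuasiIsometricEmbedding Γ Λ φ) :
    ∃ D : ℝ, ∀ x y q : V, Γ.dist x q + Γ.dist q y = Γ.dist x y →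
      gromovProduct Λ (φ q) (φ x) (φ y) ≤ D := by
  obtain ⟨L, C, hL, hC, hLC⟩ := hφ
  obtain ⟨D, hD⟩ := h.quasiGeodesic_near_geodesic hΛ hL hC
  refine ⟨D, fun x y q hq => ?_⟩
  obtain ⟨g, h0, hgq, h1, hg⟩ := exists_geodesic_through hΓ hq
  have := hD (φ ∘ g) (Γ.dist x y) (fun i j hij hj => ?_) (Γ.dist x q) (by omega)
  · simpa [h0, hgq, h1] using this
  · have := hLC (g i) (g j)
    rwa [hg i j hij hj, Nat.cast_sub hij] at this

/-- Some vertex of `[x,z]` has its image about as far from `φ x` as `φ q` is. Both images lie near a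
geodesic from `φ x` to `φ z`, so they are close, and hence `q` is close to `[x,z]`. -/
theorem IsQuasiIsometricEmbedding.gromovProduct_le_of_image_le (hΓ : Γ.Connected)
    (hΛ : Λ.Connected) {δ : ℝ} (h : FourPoint Λ δ) (hφ : IsQuasiIsometricEmbedding Γ Λ φ)
    (E : ℝ) : ∃ E' : ℝ, ∀ x z q : V, gromovProduct Λ (φ q) (φ x) (φ z) ≤ E →
      gromovProduct Γ q x z ≤ E' := by
  obtain ⟨D, hD⟩ := hφ.gromovProduct_le_of_geodesic hΓ hΛ h
  obtain ⟨L, C, hL, hC, hLC⟩ := hφ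
  refine ⟨L * (2 * max D E + 3 * (2 * E + L + C) + 2 * δ + C), fun x z q hq => ?_⟩
  have hE : 0 ≤ E := (gromovProduct_nonneg hΛ _ _ _).trans hq
  obtain ⟨g, h0, h1, hg⟩ := exists_geodesic hΓ x z
  set N := Γ.dist x z with hN
  set r := Λ.dist (φ x) (φ q) with hr
  have hrz : (r : ℝ) ≤ Λ.dist (φ x) (φ z) + 2 * E := by
    unfold gromovProduct at hq
    rw [dist_comm_real (φ q) (φ x), ← hr] at hq
    linarith [Nat.cast_nonneg (α := ℝ) (Λ.dist (φ q) (φ z))]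
  classical
  -- One step of the image moves by at most `L + C`; the `2 * E` is needed when the search stops at
  -- the end `z`.
  obtain ⟨m, hm, hle, hge⟩ : ∃ m ≤ N, (Λ.dist (φ x) (φ (g m)) : ℝ) ≤ r ∧
      (r : ℝ) ≤ Λ.dist (φ x) (φ (g m)) + (2 * E + L + C) := by
    set m := Nat.findGreatest (fun i => (Λ.dist (φ x) (φ (g i)) : ℝ) ≤ r) N with hm
    have hm1 : (Λ.dist (φ x) (φ (g m)) : ℝ) ≤ r :=
      Nat.findGreatest_spec (P := fun i => (Λ.dist (φ x) (φ (g i)) : ℝ) ≤ r) (Nat.zero_le _)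
        (by rw [h0]; simp)
    have hmN : m ≤ N := Nat.findGreatest_le _
    refine ⟨m, hmN, hm1, ?_⟩
    rcases hmN.eq_or_lt with he | hlt
    · rw [he, h1]
      linarith
    · have h3 := Nat.findGreatest_is_greatest
        (P := fun i => (Λ.dist (φ x) (φ (g i)) : ℝ) ≤ r) (Nat.lt_succ_self m) hlt
      have h4 := dist_triangle_real hΛ (φ x) (φ (g m)) (φ (g (m + 1)))
      have h5 := (hLC (g m) (g (m + 1))).2
      rw [hg m (m + 1) (by omega) hlt] at h5
      have h6 : ((m + 1 - m : ℕ) : ℝ) = 1 := by simp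
      rw [h6] at h5
      simp only [not_le] at h3
      have h3' : (r : ℝ) < Λ.dist (φ x) (φ (g (m + 1))) := h3
      linarith
  have hgm : Γ.dist x (g m) + Γ.dist (g m) z = N := by
    have h2 := hg 0 m (Nat.zero_le _) hm
    have h3 := hg m _ hm le_rfl
    rw [h0] at h2
    rw [h1] at h3
    omega
  have hnear := h.dist_le hΛ (x := φ x) (z := φ z) (v := φ q) (w := φ (g m))
    (D := max D E) (E := 2 * E + L + C) (hq.trans (le_max_right _ _))
    ((hD x z (g m) hgm).trans (le_max_left _ _)) (by rw [abs_le, ← hr]; constructor <;> linarith)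
  have h2 := (hLC q (g m)).1
  have h3 : (Γ.dist q (g m) : ℝ) / L ≤ 2 * max D E + 3 * (2 * E + L + C) + 2 * δ + C := by
    linarith
  rw [div_le_iff₀' (by linarith)] at h3
  have h4 := gromovProduct_le_add_dist_base hΓ q (g m) x z
  rw [gromovProduct_eq_zero hgm] at h4
  linarith

/-- Hyperbolicity passes to domains of quasi-isometric embeddings. -/
theorem IsQuasiIsometricEmbedding.exists_fourPoint (hΓ : Γ.Connected) (hΛ : Λ.Connected) {δ : ℝ}
    (h : FourPoint Λ δ) (hφ : IsQuasiIsometricEmbedding Γ Λ φ) : ∃ δ', FourPoint Γ δ' := by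
  obtain ⟨D, hD⟩ := hφ.gromovProduct_le_of_geodesic hΓ hΛ h
  obtain ⟨E, hE⟩ := hφ.gromovProduct_le_of_image_le hΓ hΛ h (D + δ)
  refine ⟨_, fourPoint_of_slim hΓ (δ := E) fun x y z q hq => ?_⟩
  -- In the target `φ q` is near the image side, so the four point condition puts it near one of the
  -- other two sides; `hE` pulls this back.
  have h1 := (h (φ q) (φ x) (φ y) (φ z)).trans (hD x y q hq)
  rcases min_le_iff.1 (sub_le_iff_le_add.1 h1) with h2 | h2
  · exact Or.inl (hE _ _ _ h2)
  · rw [gromovProduct_comm] at h2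
    exact Or.inr (hE _ _ _ h2)

/-- The vertex `q` is close to some `w` on a geodesic `[x,y]`, and images of geodesics are
quasi-geodesics. In particular, centres of tripods go to coarse centres. -/
theorem IsQuasiIsometricEmbedding.image_gromovProduct_le (hΓ : Γ.Connected)
    (hΛ : Λ.Connected) {δ : ℝ} (h : FourPoint Λ δ) (hφ : IsQuasiIsometricEmbedding Γ Λ φ)
    (E : ℝ) : ∃ E' : ℝ, ∀ x y q : V, gromovProduct Γ q x y ≤ E →
      gromovProduct Λ (φ q) (φ x) (φ y) ≤ E' := by
  obtain ⟨D, hD⟩ := hφ.gromovProduct_le_of_geodesic hΓ hΛ h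
  obtain ⟨δ', h'⟩ := hφ.exists_fourPoint hΓ hΛ h
  obtain ⟨L, C, hL, hC, hLC⟩ := hφ
  refine ⟨D + (L * (2 * E + 3 * (2 * E) + 2 * δ') + C), fun x y q hq => ?_⟩
  have hE : 0 ≤ E := (gromovProduct_nonneg hΓ _ _ _).trans hq
  obtain ⟨w, hw, hw'⟩ := exists_dist_eq hΓ x y (min_le_right (Γ.dist x q) (Γ.dist x y))
  have h1 : (Γ.dist x q : ℝ) ≤ Γ.dist x y + 2 * E := by
    unfold gromovProduct at hq
    rw [dist_comm_real q x] at hq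
    linarith [Nat.cast_nonneg (α := ℝ) (Γ.dist q y)]
  have hnear := h'.dist_le hΓ (x := x) (z := y) (v := q) (w := w) (E := 2 * E) hq
    (by rw [gromovProduct_eq_zero hw']; exact hE) (by
      rw [hw, Nat.cast_min, abs_le]
      constructor
      · linarith [min_le_left (Γ.dist x q : ℝ) (Γ.dist x y : ℝ)]
      · rw [sub_le_comm, le_min_iff]
        constructor <;> linarith)
  have h2 := (hLC q w).2
  have h3 : L * Γ.dist q w ≤ L * (2 * E + 3 * (2 * E) + 2 * δ') := by gcongr
  have h4 := gromovProduct_le_add_dist_base hΛ (φ q) (φ w) (φ x) (φ y)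
  linarith [hD x y w hw']

/-- The branch point of the tripod spanned by `p`, `a`, `c`. -/
theorem FourPoint.exists_center (hΓ : Γ.Connected) {δ : ℝ} (h : FourPoint Γ δ) (p a c : V) :
    ∃ q, gromovProduct Γ q p a = 0 ∧ gromovProduct Γ q p c ≤ δ ∧ gromovProduct Γ q a c ≤ δ + 1 ∧
      (Γ.dist p q : ℝ) ≤ gromovProduct Γ p a c ∧ gromovProduct Γ p a c ≤ Γ.dist p q + 1 := by
  have h0 := gromovProduct_nonneg hΓ p a c
  have hle : ⌊gromovProduct Γ p a c⌋₊ ≤ Γ.dist p a := by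
    exact_mod_cast (Nat.floor_le h0).trans (gromovProduct_le_dist_left hΓ p a c)
  obtain ⟨q, hq, hq'⟩ := exists_dist_eq hΓ p a hle
  have h1 : (Γ.dist p q : ℝ) ≤ gromovProduct Γ p a c := by rw [hq]; exact Nat.floor_le h0
  have h2 : gromovProduct Γ p a c ≤ Γ.dist p q + 1 := by
    rw [hq]; exact (Nat.lt_floor_add_one _).le
  have h3 := gromovProduct_eq_zero hq'
  have h4 := gromovProduct_change_base (Γ := Γ) p q a c
  have h5 := h q p a c
  rw [h3] at h4 h5
  -- If instead `(a.c)_q ≤ δ`, changing the base point gives the same bound, because `d(p,q) ≤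
  -- (a.c)_p`.
  have h6 : gromovProduct Γ q p c ≤ δ := by
    rcases min_le_iff.1 (sub_nonpos.1 h5) with h7 | h7
    · exact h7
    · rw [gromovProduct_comm] at h7
      linarith
  exact ⟨q, h3, h6, by linarith, h1, h2⟩

/-- Quasi-isometric embeddings coarsely preserve the order of inner products with a common
point. -/
theorem IsQuasiIsometricEmbedding.gromovProduct_order (hΓ : Γ.Connected)
    (hΛ : Λ.Connected) {δ : ℝ} (h : FourPoint Λ δ) (hφ : IsQuasiIsometricEmbedding Γ Λ φ)
    (C : ℝ) : ∃ C' : ℝ, ∀ p a b c : V, gromovProduct Γ p a c - C ≤ gromovProduct Γ p a b →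
      gromovProduct Λ (φ p) (φ a) (φ c) - C' ≤ gromovProduct Λ (φ p) (φ a) (φ b) := by
  obtain ⟨δ', h'⟩ := hφ.exists_fourPoint hΓ hΛ h
  obtain ⟨E, hE⟩ := hφ.image_gromovProduct_le hΓ hΛ h (δ' + 1 + |C|)
  have hδ' := h'.nonneg hΓ
  refine ⟨3 * E, fun p a b c hab => ?_⟩
  obtain ⟨q, h1, -, h3, h4, -⟩ := h'.exists_center hΓ p a c
  have hC := le_abs_self C
  have hC0 := abs_nonneg C
  have h6 := gromovProduct_change_base (Γ := Γ) p q a b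
  rw [h1] at h6
  -- By assumption `b` leaves `[p,a]` at most about `C` before the centre `q`. After mapping,
  -- `(a.c)_p` is at most `d(p,q) + E` and `(a.b)_p` at least `d(p,q) - 2E` for the images, whence
  -- `3 * E`.
  have h7 : gromovProduct Γ q p b ≤ δ' + |C| := by
    have h8 := h' q p a b
    rw [h1, sub_nonpos] at h8
    rcases min_le_iff.1 h8 with h9 | h9
    · linarith
    · rw [gromovProduct_comm] at h9
      linarith
  have e1 := hE p a q (by linarith)
  have e2 := hE p b q (by linarith)
  have e3 := hE a c q (by linarith)
  rw [gromovProduct_change_base (φ p) (φ q) (φ a) (φ c),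
    gromovProduct_change_base (φ p) (φ q) (φ a) (φ b)]
  linarith [gromovProduct_nonneg hΛ (φ q) (φ p) (φ a), gromovProduct_nonneg hΛ (φ q) (φ p) (φ c),
    gromovProduct_nonneg hΛ (φ q) (φ a) (φ b)]

/-- A product based at `p` is, up to a constant, the distance from `p` to the centre. Centres go to
coarse centres, so the affine bounds on distances carry over. -/
theorem IsQuasiIsometricEmbedding.gromovProduct_bounds (hΓ : Γ.Connected)
    (hΛ : Λ.Connected) {δ : ℝ} (h : FourPoint Λ δ) (hφ : IsQuasiIsometricEmbedding Γ Λ φ) :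
    ∃ L C : ℝ, 1 ≤ L ∧ ∀ p a b : V,
      gromovProduct Γ p a b / L - C ≤ gromovProduct Λ (φ p) (φ a) (φ b) ∧
        gromovProduct Λ (φ p) (φ a) (φ b) ≤ L * gromovProduct Γ p a b + C := by
  obtain ⟨δ', h'⟩ := hφ.exists_fourPoint hΓ hΛ h
  have hδ' := h'.nonneg hΓ
  obtain ⟨E, hE⟩ := hφ.image_gromovProduct_le hΓ hΛ h (δ' + 1)
  obtain ⟨L, C, hL, hC, hLC⟩ := hφ
  refine ⟨L, C + 2 * E + 1, hL, fun p a b => ?_⟩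
  obtain ⟨q, h1, h2, h3, h4, h5⟩ := h'.exists_center hΓ p a b
  have e1 := hE p a q (by linarith)
  have e2 := hE p b q (by linarith)
  have e3 := hE a b q (by linarith)
  have n1 := gromovProduct_nonneg hΛ (φ q) (φ p) (φ a)
  have n2 := gromovProduct_nonneg hΛ (φ q) (φ p) (φ b)
  have n3 := gromovProduct_nonneg hΛ (φ q) (φ a) (φ b)
  rw [gromovProduct_change_base (φ p) (φ q) (φ a) (φ b)]
  have hpq := hLC p q
  constructor
  · have h6 : gromovProduct Γ p a b / L ≤ (Γ.dist p q + 1) / L := by gcongr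
    have h7 : (1 : ℝ) / L ≤ 1 := by rw [div_le_one (by linarith)]; exact hL
    rw [add_div] at h6
    linarith
  · have h6 : L * Γ.dist p q ≤ L * gromovProduct Γ p a b := by gcongr
    linarith

end QuasiIsometry
end HypGraph

namespace HypGraph

/-! ### Sequences and boundary points -/

section Asymptotic

variable {V : Type*} {Γ : SimpleGraph V}

/-- `(u(m).v(n))_p → ∞` as `m, n → ∞`. -/
def Asymptotic (Γ : SimpleGraph V) (u v : ℕ → V) : Prop :=
  ∀ (p : V) (t : ℝ), ∃ N, ∀ m ≥ N, ∀ n ≥ N, t ≤ gromovProduct Γ p (u m) (v n)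

theorem convergesTo_iff {u : ℕ → V} {ξ : Boundary Γ} :
    ConvergesTo Γ u ξ ↔ ∃ r : GeodesicRay Γ, Boundary.mk r = ξ ∧ Asymptotic Γ u r.toFun := by
  refine exists_congr fun r => and_congr_right fun _ => forall_congr' fun p => ?_
  rw [tendsto_atTop]
  refine forall_congr' fun t => ?_
  rw [eventually_atTop]
  constructor
  · rintro ⟨a, ha⟩
    exact ⟨max a.1 a.2, fun m hm n hn =>
      ha (m, n) ⟨(le_max_left _ _).trans hm, (le_max_right _ _).trans hn⟩⟩
  · rintro ⟨N, hN⟩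
    exact ⟨(N, N), fun b hb => hN b.1 hb.1 b.2 hb.2⟩

theorem Asymptotic.of_base (hc : Γ.Connected) {u v : ℕ → V} (p : V)
    (h : ∀ t : ℝ, ∃ N, ∀ m ≥ N, ∀ n ≥ N, t ≤ gromovProduct Γ p (u m) (v n)) :
    Asymptotic Γ u v := by
  intro q t
  obtain ⟨N, hN⟩ := h (t + Γ.dist p q)
  refine ⟨N, fun m hm n hn => ?_⟩
  linarith [hN m hm n hn, gromovProduct_le_add_dist_base hc p q (u m) (v n)]

theorem Asymptotic.symm {u v : ℕ → V} (h : Asymptotic Γ u v) : Asymptotic Γ v u := by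
  intro p t
  obtain ⟨N, hN⟩ := h p t
  refine ⟨N, fun m hm n hn => ?_⟩
  rw [gromovProduct_comm]
  exact hN n hn m hm

theorem Asymptotic.trans {δ : ℝ} (hδ : FourPoint Γ δ) {u v w : ℕ → V} (h : Asymptotic Γ u v)
    (h' : Asymptotic Γ v w) : Asymptotic Γ u w := by
  intro p t
  obtain ⟨N, hN⟩ := h p (t + δ)
  obtain ⟨N', hN'⟩ := h' p (t + δ)
  refine ⟨max N N', fun m hm n hn => ?_⟩
  have := hδ.le (hN m ((le_max_left _ _).trans hm) (max N N') (le_max_left _ _))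
    (hN' (max N N') (le_max_right _ _) n ((le_max_right _ _).trans hn))
  linarith

theorem GeodesicRay.gromovProduct_eq (r : GeodesicRay Γ) {m n : ℕ} (h : m ≤ n) :
    gromovProduct Γ (r.toFun 0) (r.toFun m) (r.toFun n) = m := by
  unfold gromovProduct
  rw [r.dist_eq 0 m (Nat.zero_le _), r.dist_eq 0 n (Nat.zero_le _), r.dist_eq m n h,
    Nat.cast_sub h]
  simp only [Nat.sub_zero]
  ring

theorem GeodesicRay.asymptotic_self (hc : Γ.Connected) (r : GeodesicRay Γ) :
    Asymptotic Γ r.toFun r.toFun := by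
  refine Asymptotic.of_base hc (r.toFun 0) fun t => ⟨⌈t⌉₊, fun m hm n hn => ?_⟩
  rcases le_total m n with h | h
  · rw [r.gromovProduct_eq h]
    exact Nat.ceil_le.1 hm
  · rw [gromovProduct_comm, r.gromovProduct_eq h]
    exact Nat.ceil_le.1 hn

theorem GeodesicRay.mk_eq_iff (hc : Γ.Connected) {δ : ℝ} (hδ : FourPoint Γ δ)
    (r s : GeodesicRay Γ) :
    Boundary.mk r = Boundary.mk s ↔ Asymptotic Γ r.toFun s.toFun := by
  have hδ0 := hδ.nonneg hc
  constructor
  · intro h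
    obtain ⟨K, hK⟩ : (raySetoid Γ).r r s := Quotient.exact h
    intro p t
    obtain ⟨N, hN⟩ := r.asymptotic_self hc p (t + K)
    refine ⟨N, fun m hm n hn => ?_⟩
    have h1 : (Γ.dist (r.toFun n) (s.toFun n) : ℝ) ≤ K := by
      have := hK n
      rw [← (hc.preconnected _ _).coe_dist_eq_edist] at this
      exact_mod_cast this
    have h2 := gromovProduct_le_add_dist_right hc p (r.toFun m) (r.toFun n) (s.toFun n)
    linarith [hN m hm n hn]
  · intro h
    -- With `E` the distance of the starting points, passing through far points of both rays gives
    -- `(r n . s n) ≥ n - E - 2δ` at `r 0`; moreover `s n` is within `n + E` of `r 0`.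
    refine Quotient.sound ⟨⌈3 * (Γ.dist (r.toFun 0) (s.toFun 0) : ℝ) + 4 * δ⌉₊, fun n => ?_⟩
    rw [← (hc.preconnected _ _).coe_dist_eq_edist]
    norm_cast
    rw [← Nat.cast_le (α := ℝ)]
    push_cast
    refine le_trans ?_ (Nat.le_ceil _)
    set E : ℝ := (Γ.dist (r.toFun 0) (s.toFun 0) : ℝ) with hE
    obtain ⟨N, hN⟩ := h (r.toFun 0) n
    have h1 := r.gromovProduct_eq (le_max_right N n)
    have h2 := s.gromovProduct_eq (le_max_right N n)
    have h3 := hN _ (le_max_left N n) _ (le_max_left N n)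
    have h4 := gromovProduct_le_add_dist_base hc (s.toFun 0) (r.toFun 0) (s.toFun n)
      (s.toFun (max N n))
    rw [dist_comm_real (s.toFun 0), ← hE] at h4
    have hE0 : 0 ≤ E := Nat.cast_nonneg _
    have h5 := hδ.le (t := n - E) (x := r.toFun n) (by linarith) (by linarith : n - E ≤ _)
    have h6 := hδ.le (t := n - E - δ) (x := r.toFun n) (y := s.toFun n) (by linarith)
      (by rw [gromovProduct_comm]; linarith)
    have h7 := dist_triangle_real hc (r.toFun 0) (s.toFun 0) (s.toFun n)
    rw [s.dist_eq 0 n (Nat.zero_le _), Nat.sub_zero] at h7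
    unfold gromovProduct at h6
    rw [r.dist_eq 0 n (Nat.zero_le _), Nat.sub_zero] at h6
    linarith

theorem ConvergesTo.asymptotic_ray (hc : Γ.Connected) {δ : ℝ} (hδ : FourPoint Γ δ) {u : ℕ → V}
    {ξ : Boundary Γ} (h : ConvergesTo Γ u ξ) {r : GeodesicRay Γ} (hr : Boundary.mk r = ξ) :
    Asymptotic Γ u r.toFun := by
  obtain ⟨s, hs, hus⟩ := convergesTo_iff.1 h
  exact hus.trans hδ ((s.mk_eq_iff hc hδ r).1 (hs.trans hr.symm))

theorem ConvergesTo.asymptotic (hc : Γ.Connected) {δ : ℝ} (hδ : FourPoint Γ δ) {u v : ℕ → V}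
    {ξ : Boundary Γ} (hu : ConvergesTo Γ u ξ) (hv : ConvergesTo Γ v ξ) : Asymptotic Γ u v := by
  obtain ⟨s, hs, hus⟩ := convergesTo_iff.1 hu
  exact hus.trans hδ (hv.asymptotic_ray hc hδ hs).symm

theorem ConvergesTo.congr {δ : ℝ} (hδ : FourPoint Γ δ) {u v : ℕ → V}
    {ξ : Boundary Γ} (hu : ConvergesTo Γ u ξ) (hv : Asymptotic Γ v u) : ConvergesTo Γ v ξ := by
  obtain ⟨s, hs, hus⟩ := convergesTo_iff.1 hu
  exact convergesTo_iff.2 ⟨s, hs, hv.trans hδ hus⟩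

theorem ConvergesTo.unique (hc : Γ.Connected) {δ : ℝ} (hδ : FourPoint Γ δ) {u : ℕ → V}
    {ξ η : Boundary Γ} (h : ConvergesTo Γ u ξ) (h' : ConvergesTo Γ u η) : ξ = η := by
  obtain ⟨r, hr, hur⟩ := convergesTo_iff.1 h
  obtain ⟨s, hs, hus⟩ := convergesTo_iff.1 h'
  rw [← hr, ← hs, r.mk_eq_iff hc hδ s]
  exact hur.symm.trans hδ hus

theorem exists_convergesTo_of_mk (hc : Γ.Connected) (ξ : Boundary Γ) :
    ∃ r : GeodesicRay Γ, ConvergesTo Γ r.toFun ξ := by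
  obtain ⟨r, hr⟩ := Quotient.exists_rep ξ
  exact ⟨r, convergesTo_iff.2 ⟨r, hr, r.asymptotic_self hc⟩⟩

/-- In a graph with finite balls, a sequence converging at infinity converges to a boundary
point. The ray is a limit along an ultrafilter of geodesics to the points of the sequence. -/
theorem exists_convergesTo_of_asymptotic (hc : Γ.Connected) {δ : ℝ} (hδ : FourPoint Γ δ)
    (hfin : ∀ (p : V) (n : ℕ), {x | Γ.dist p x ≤ n}.Finite) {u : ℕ → V}
    (hu : Asymptotic Γ u u) : ∃ ξ : Boundary Γ, ConvergesTo Γ u ξ := by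
  obtain ⟨p⟩ := hc.nonempty
  choose g hg0 hg1 hg using fun m => exists_geodesic hc p (u m)
  -- For fixed `n`, the vertices `g m n` eventually lie in a finite ball, so they are constant along
  -- `U`. This replaces a diagonal choice of subsequences.
  let U : Ultrafilter ℕ := Ultrafilter.of atTop
  have hU : (U : Filter ℕ) ≤ atTop := Ultrafilter.of_le atTop
  have hfar : ∀ n : ℕ, ∀ᶠ m in (U : Filter ℕ), n ≤ Γ.dist p (u m) := by
    intro n
    refine hU ?_
    obtain ⟨N, hN⟩ := hu p n
    filter_upwards [eventually_ge_atTop N] with m hm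
    have := hN m hm m hm
    rw [gromovProduct_self_right] at this
    exact_mod_cast this
  have hlim : ∀ n : ℕ, ∃ v, ∀ᶠ m in (U : Filter ℕ), g m n = v := by
    intro n
    have h1 : ∀ᶠ m in (U : Filter ℕ), ∃ v ∈ {x | Γ.dist p x ≤ n}, g m n = v := by
      filter_upwards [hfar n] with m hm
      refine ⟨_, ?_, rfl⟩
      have := hg m 0 n (Nat.zero_le _) hm
      rw [hg0] at this
      simp [this]
    obtain ⟨v, -, hv⟩ := (Ultrafilter.eventually_exists_mem_iff (hfin p n)).1 h1
    exact ⟨v, hv⟩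
  choose r hr using hlim
  have hray : ∀ a b : ℕ, a ≤ b → Γ.dist (r a) (r b) = b - a := by
    intro a b hab
    obtain ⟨m, h1, h2, h3⟩ := ((hr a).and ((hr b).and (hfar b))).exists
    rw [← h1, ← h2]
    exact hg m a b hab h3
  refine ⟨Boundary.mk ⟨r, hray⟩, convergesTo_iff.2 ⟨_, rfl, Asymptotic.of_base hc p fun t => ?_⟩⟩
  obtain ⟨N, hN⟩ := hu p (t + δ)
  refine ⟨max N ⌈t + δ⌉₊, fun m hm n hn => ?_⟩
  obtain ⟨m', h1, h2, h3⟩ :=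
    ((hr n).and ((hfar n).and (hU (eventually_ge_atTop N)))).exists
  have h4 : gromovProduct Γ p (u m') (r n) = n := by
    have e1 := hg m' 0 n (Nat.zero_le _) h2
    have e2 := hg m' n _ h2 le_rfl
    rw [hg0] at e1
    rw [hg1, SimpleGraph.dist_comm] at e2
    unfold gromovProduct
    rw [← h1, e1, e2, Nat.cast_sub h2]
    simp
  have h5 : t + δ ≤ n := Nat.ceil_le.1 ((le_max_right _ _).trans hn)
  have := hδ.le (hN m ((le_max_left _ _).trans hm) m' h3) (h4 ▸ h5)
  simpa using this

/-- Two applications of the four point condition, through one late pair `u' m'`, `v' n'`, control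
all late pairs. Hence any two approximating pairs of sequences give the same boundary product up to
`2δ`. -/
theorem Asymptotic.eventually_le {δ : ℝ} (hδ : FourPoint Γ δ) {u u' v v' : ℕ → V}
    (hu : Asymptotic Γ u u') (hv : Asymptotic Γ v v') {p : V} {t : ℝ}
    (h : ∀ N, ∃ m ≥ N, ∃ n ≥ N, t ≤ gromovProduct Γ p (u' m) (v' n)) :
    ∃ N, ∀ m ≥ N, ∀ n ≥ N, t - 2 * δ ≤ gromovProduct Γ p (u m) (v n) := by
  obtain ⟨N₁, h1⟩ := hu p t
  obtain ⟨N₂, h2⟩ := hv p (t - δ)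
  obtain ⟨m', hm', n', hn', h3⟩ := h (max N₁ N₂)
  refine ⟨max N₁ N₂, fun m hm n hn => ?_⟩
  have h4 := hδ.le (h1 m ((le_max_left _ _).trans hm) m' ((le_max_left _ _).trans hm')) h3
  have h5 := h2 n ((le_max_right _ _).trans hn) n' ((le_max_right _ _).trans hn')
  rw [gromovProduct_comm] at h5
  linarith [hδ.le h4 h5]

theorem le_boundaryProduct {δ : ℝ} (hc : Γ.Connected) (hδ : FourPoint Γ δ) {u v : ℕ → V}
    {ξ η : Boundary Γ} (hu : ConvergesTo Γ u ξ) (hv : ConvergesTo Γ v η) {p : V} {t : ℝ}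
    (h : ∀ N, ∃ m ≥ N, ∃ n ≥ N, t ≤ gromovProduct Γ p (u m) (v n)) :
    ENNReal.ofReal (t - 2 * δ) ≤ boundaryProduct Γ p ξ η := by
  obtain ⟨N, hN⟩ := (hu.asymptotic hc hδ hu).eventually_le hδ (hv.asymptotic hc hδ hv) h
  refine le_trans ?_ (le_iSup₂_of_le u v (le_iSup₂_of_le hu hv le_rfl))
  refine le_liminf_of_le (by isBoundedDefault) ?_
  filter_upwards [eventually_ge_atTop (N, N)] with n hn
  exact ENNReal.ofReal_le_ofReal (hN _ hn.1 _ hn.2)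

theorem eventually_le_of_lt_boundaryProduct {δ : ℝ} (hc : Γ.Connected) (hδ : FourPoint Γ δ)
    {u v : ℕ → V} {ξ η : Boundary Γ} (hu : ConvergesTo Γ u ξ) (hv : ConvergesTo Γ v η) {p : V}
    {t : ℝ} (h : ENNReal.ofReal t < boundaryProduct Γ p ξ η) :
    ∃ N, ∀ m ≥ N, ∀ n ≥ N, t - 2 * δ ≤ gromovProduct Γ p (u m) (v n) := by
  unfold boundaryProduct at h
  simp only [lt_iSup_iff] at h
  obtain ⟨u', v', hu', hv', hlt⟩ := h
  have h1 := eventually_lt_of_lt_liminf hlt (by isBoundedDefault)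
  refine (hu.asymptotic hc hδ hu').eventually_le hδ (hv.asymptotic hc hδ hv') fun N => ?_
  obtain ⟨n, h2, h3⟩ := (h1.and (eventually_ge_atTop (N, N))).exists
  refine ⟨n.1, h3.1, n.2, h3.2, ?_⟩
  exact (ENNReal.ofReal_lt_ofReal_iff'.1 h2).1.le

end Asymptotic
end HypGraph

namespace HypGraph

/-! ### Powers with exponents in `[0, ∞]` -/

section PowNeg

variable {a : ℝ}

theorem powNeg_top : powNeg a ∞ = 0 := if_pos rfl

theorem powNeg_of_ne_top {t : ℝ≥0∞} (ht : t ≠ ∞) : powNeg a t = a ^ (-t.toReal) := if_neg ht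

theorem powNeg_nonneg (ha : 1 < a) (t : ℝ≥0∞) : 0 ≤ powNeg a t := by
  unfold powNeg
  split_ifs
  · rfl
  · exact Real.rpow_nonneg (by linarith) _

theorem powNeg_le_rpow (ha : 1 < a) {T : ℝ} {t : ℝ≥0∞} (h : ENNReal.ofReal T ≤ t) :
    powNeg a t ≤ a ^ (-T) := by
  by_cases ht : t = ∞
  · rw [ht, powNeg_top]
    exact Real.rpow_nonneg (by linarith) _
  · rw [powNeg_of_ne_top ht]
    exact Real.rpow_le_rpow_of_exponent_le ha.le
      (neg_le_neg ((ENNReal.ofReal_le_iff_le_toReal ht).1 h))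

theorem powNeg_le_mul_powNeg (ha : 1 < a) {C : ℝ} (hC : 0 ≤ C) {s t : ℝ≥0∞}
    (h : s ≤ t + ENNReal.ofReal C) : powNeg a t ≤ a ^ C * powNeg a s := by
  have ha0 : 0 < a := by linarith
  by_cases ht : t = ∞
  · rw [ht, powNeg_top]
    exact mul_nonneg (Real.rpow_nonneg ha0.le _) (powNeg_nonneg ha _)
  · have hfin : t + ENNReal.ofReal C ≠ ∞ := ENNReal.add_ne_top.2 ⟨ht, ENNReal.ofReal_ne_top⟩
    have hs : s ≠ ∞ := ne_top_of_le_ne_top hfin h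
    rw [powNeg_of_ne_top ht, powNeg_of_ne_top hs, ← Real.rpow_add ha0]
    refine Real.rpow_le_rpow_of_exponent_le ha.le ?_
    have := ENNReal.toReal_mono hfin h
    rw [ENNReal.toReal_add ht ENNReal.ofReal_ne_top, ENNReal.toReal_ofReal hC] at this
    linarith

/-- Logarithms turn the factor between distances into an additive error between products. -/
theorem ofReal_sub_logb_le (ha : 1 < a) {M : ℝ} (hM : 0 < M) {s t : ℝ≥0∞} (hs : s ≠ ∞)
    (h : powNeg a t ≤ M * powNeg a s) : ENNReal.ofReal (s.toReal - Real.logb a M) ≤ t := by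
  have ha0 : 0 < a := by linarith
  by_cases ht : t = ∞
  · rw [ht]
    exact le_top
  · rw [powNeg_of_ne_top ht, powNeg_of_ne_top hs] at h
    nth_rewrite 1 [← Real.rpow_logb ha0 ha.ne' hM] at h
    rw [← Real.rpow_add ha0, Real.rpow_le_rpow_left_iff ha] at h
    exact ENNReal.ofReal_le_of_le_toReal (by linarith)

theorem ofReal_lt_of_powNeg_lt (ha : 1 < a) {T : ℝ} (hT : 0 ≤ T) {t : ℝ≥0∞}
    (h : powNeg a t < a ^ (-T)) : ENNReal.ofReal T < t := by
  by_cases ht : t = ∞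
  · rw [ht]
    exact ENNReal.ofReal_lt_top
  · rw [powNeg_of_ne_top ht, Real.rpow_lt_rpow_left_iff ha] at h
    exact (ENNReal.ofReal_lt_iff_lt_toReal hT ht).2 (by linarith)

end PowNeg

/-! ### The boundary map of a quasi-isometric embedding -/

section BoundaryMap

variable {V W : Type*} {Γ : SimpleGraph V} {Λ : SimpleGraph W} {φ : V → W}

theorem IsQuasiIsometricEmbedding.asymptotic_iff (hΓ : Γ.Connected) (hΛ : Λ.Connected) {δ : ℝ}
    (h : FourPoint Λ δ) (hφ : IsQuasiIsometricEmbedding Γ Λ φ) {u v : ℕ → V} :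
    Asymptotic Λ (φ ∘ u) (φ ∘ v) ↔ Asymptotic Γ u v := by
  obtain ⟨p⟩ := hΓ.nonempty
  obtain ⟨L, C, hL, hLC⟩ := hφ.gromovProduct_bounds hΓ hΛ h
  have hL0 : 0 < L := by linarith
  constructor
  · intro huv
    refine Asymptotic.of_base hΓ p fun t => ?_
    obtain ⟨N, hN⟩ := huv (φ p) (L * t + C)
    refine ⟨N, fun m hm n hn => ?_⟩
    have := (hN m hm n hn).trans (hLC p (u m) (v n)).2
    exact le_of_mul_le_mul_left (by linarith) hL0
  · intro huv
    refine Asymptotic.of_base hΛ (φ p) fun t => ?_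
    obtain ⟨N, hN⟩ := huv p (L * (t + C))
    refine ⟨N, fun m hm n hn => ?_⟩
    have h1 := (hLC p (u m) (v n)).1
    have h2 : t + C ≤ gromovProduct Γ p (u m) (v n) / L := by
      rw [le_div_iff₀' hL0]
      exact hN m hm n hn
    exact le_trans (by linarith) h1

/-- A quasi-isometric embedding of hyperbolic graphs with finite balls induces a map of boundaries
onto the limit set of its image. -/
theorem IsQuasiIsometricEmbedding.exists_boundaryMap (hΓ : Γ.Connected) (hΛ : Λ.Connected)
    {δ : ℝ} (h : FourPoint Λ δ) (hφ : IsQuasiIsometricEmbedding Γ Λ φ)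
    (hfΓ : ∀ (p : V) (n : ℕ), {x | Γ.dist p x ≤ n}.Finite)
    (hfΛ : ∀ (p : W) (n : ℕ), {x | Λ.dist p x ≤ n}.Finite) :
    ∃ F : Boundary Γ → Boundary Λ,
      (∀ ξ u, ConvergesTo Γ u ξ → ConvergesTo Λ (φ ∘ u) (F ξ)) ∧
        Set.range F = limitSet Λ (Set.range φ) := by
  obtain ⟨δ', h'⟩ := hφ.exists_fourPoint hΓ hΛ h
  choose r hr using exists_convergesTo_of_mk (Γ := Γ) hΓ
  have hex : ∀ ξ, ∃ η, ConvergesTo Λ (φ ∘ (r ξ).toFun) η := fun ξ =>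
    exists_convergesTo_of_asymptotic hΛ h hfΛ
      ((hφ.asymptotic_iff hΓ hΛ h).2 ((r ξ).asymptotic_self hΓ))
  choose F hF using hex
  have hconv : ∀ ξ u, ConvergesTo Γ u ξ → ConvergesTo Λ (φ ∘ u) (F ξ) := fun ξ u hu =>
    (hF ξ).congr h ((hφ.asymptotic_iff hΓ hΛ h).2 (hu.asymptotic hΓ h' (hr ξ)))
  refine ⟨F, hconv, Set.Subset.antisymm ?_ ?_⟩
  · rintro _ ⟨ξ, rfl⟩
    exact ⟨φ ∘ (r ξ).toFun, fun n => ⟨_, rfl⟩, hF ξ⟩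
  · rintro η ⟨u, hu, huη⟩
    choose y hy using hu
    obtain rfl : φ ∘ y = u := funext hy
    obtain ⟨ξ, hξ⟩ := exists_convergesTo_of_asymptotic hΓ h' hfΓ
      -- Convergence of the image sequence forces the chosen preimages to converge at infinity, so
      -- every limit point is attained.
      ((hφ.asymptotic_iff hΓ hΛ h).1 (huη.asymptotic hΛ h huη))
    exact ⟨ξ, (hconv ξ y hξ).unique hΛ h huη⟩

/-- The boundary map coarsely preserves the order of inner products with a common point. -/
theorem IsQuasiIsometricEmbedding.boundaryProduct_order (hΓ : Γ.Connected) (hΛ : Λ.Connected)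
    {δ : ℝ} (h : FourPoint Λ δ) (hφ : IsQuasiIsometricEmbedding Γ Λ φ)
    {F : Boundary Γ → Boundary Λ}
    (hF : ∀ ξ u, ConvergesTo Γ u ξ → ConvergesTo Λ (φ ∘ u) (F ξ)) (p : V) (q : W) (C : ℝ) :
    ∃ C' : ℝ, 0 ≤ C' ∧ ∀ ξ η ζ : Boundary Γ, boundaryProduct Γ p ξ ζ ≠ ∞ →
      ENNReal.ofReal ((boundaryProduct Γ p ξ ζ).toReal - C) ≤ boundaryProduct Γ p ξ η →
      boundaryProduct Λ q (F ξ) (F ζ) ≤ boundaryProduct Λ q (F ξ) (F η) + ENNReal.ofReal C' := by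
  obtain ⟨δ', h'⟩ := hφ.exists_fourPoint hΓ hΛ h
  -- Each of the two boundary products is replaced by late vertex products with error `2δ' + 1`.
  obtain ⟨C₁, hC₁⟩ := hφ.gromovProduct_order hΓ hΛ h (4 * δ' + 2 + C)
  set E : ℝ := (Λ.dist q (φ p) : ℝ) with hE
  refine ⟨|C₁ + 2 * E + 4 * δ|, abs_nonneg _, fun ξ η ζ hfin hle => ?_⟩
  set s := (boundaryProduct Γ p ξ ζ).toReal with hs
  obtain ⟨u, hu⟩ := exists_convergesTo_of_mk hΓ ξ
  obtain ⟨v, hv⟩ := exists_convergesTo_of_mk hΓ η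
  obtain ⟨w, hw⟩ := exists_convergesTo_of_mk hΓ ζ
  obtain ⟨N₁, h1⟩ : ∃ N, ∀ m ≥ N, ∀ n ≥ N,
      gromovProduct Γ p (u.toFun m) (w.toFun n) < s + 1 + 2 * δ' := by
    by_contra! hcon
    have h2 := le_boundaryProduct hΓ h' hu hw hcon
    rw [add_sub_cancel_right, ENNReal.ofReal_le_iff_le_toReal hfin] at h2
    linarith
  obtain ⟨N₂, h2⟩ : ∃ N, ∀ m ≥ N, ∀ n ≥ N,
      s - C - 1 - 2 * δ' ≤ gromovProduct Γ p (u.toFun m) (v.toFun n) := by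
    rcases lt_or_ge (s - C - 1) 0 with hneg | hpos
    · refine ⟨0, fun m _ n _ => ?_⟩
      linarith [gromovProduct_nonneg hΓ p (u.toFun m) (v.toFun n), h'.nonneg hΓ]
    · refine eventually_le_of_lt_boundaryProduct hΓ h' hu hv (lt_of_lt_of_le ?_ hle)
      rw [ENNReal.ofReal_lt_ofReal_iff_of_nonneg hpos]
      linarith
  have h3 : ∀ m ≥ max N₁ N₂, ∀ n ≥ max N₁ N₂,
      gromovProduct Λ q (φ (u.toFun m)) (φ (w.toFun n)) - (C₁ + 2 * E) ≤
        gromovProduct Λ q (φ (u.toFun m)) (φ (v.toFun n)) := by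
    intro m hm n hn
    have e1 := h1 m ((le_max_left _ _).trans hm) n ((le_max_left _ _).trans hn)
    have e2 := h2 m ((le_max_right _ _).trans hm) n ((le_max_right _ _).trans hn)
    have e3 := hC₁ p (u.toFun m) (v.toFun n) (w.toFun n) (by linarith)
    have e4 := gromovProduct_le_add_dist_base hΛ q (φ p) (φ (u.toFun m)) (φ (w.toFun n))
    have e5 := gromovProduct_le_add_dist_base hΛ (φ p) q (φ (u.toFun m)) (φ (v.toFun n))
    rw [dist_comm_real (φ p) q] at e5
    linarith
  -- Testing against finite `t` treats an infinite product on the left without a separate case.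
  refine ENNReal.le_of_forall_nnreal_lt fun t ht => ?_
  rw [← ENNReal.ofReal_coe_nnreal] at ht ⊢
  obtain ⟨N₃, h4⟩ := eventually_le_of_lt_boundaryProduct hΛ h (hF ξ _ hu) (hF ζ _ hw) ht
  have h5 := le_boundaryProduct hΛ h (hF ξ _ hu) (hF η _ hv) (p := q)
    (t := t - 2 * δ - (C₁ + 2 * E)) fun N => by
      refine ⟨max N (max (max N₁ N₂) N₃), le_max_left _ _, max N (max (max N₁ N₂) N₃),
        le_max_left _ _, ?_⟩
      have hb : max (max N₁ N₂) N₃ ≤ max N (max (max N₁ N₂) N₃) := le_max_right _ _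
      have e1 := h3 _ ((le_max_left _ _).trans hb) _ ((le_max_left _ _).trans hb)
      have e2 := h4 _ ((le_max_right _ _).trans hb) _ ((le_max_right _ _).trans hb)
      simp only [Function.comp_apply] at e2 ⊢
      linarith
  calc ENNReal.ofReal t
      ≤ ENNReal.ofReal (t - 2 * δ - (C₁ + 2 * E) - 2 * δ + |C₁ + 2 * E + 4 * δ|) :=
        ENNReal.ofReal_le_ofReal (by linarith [le_abs_self (C₁ + 2 * E + 4 * δ)])
    _ ≤ _ := ENNReal.ofReal_add_le
    _ ≤ _ := by gcongr

theorem IsQuasiIsometricEmbedding.le_boundaryProduct_image (hΓ : Γ.Connected) (hΛ : Λ.Connected)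
    {δ : ℝ} (h : FourPoint Λ δ) (hφ : IsQuasiIsometricEmbedding Γ Λ φ)
    {F : Boundary Γ → Boundary Λ}
    (hF : ∀ ξ u, ConvergesTo Γ u ξ → ConvergesTo Λ (φ ∘ u) (F ξ)) (p : V) (q : W) (T : ℝ) :
    ∃ T' : ℝ, 0 ≤ T' ∧ ∀ ξ η : Boundary Γ, ENNReal.ofReal T' < boundaryProduct Γ p ξ η →
      ENNReal.ofReal T ≤ boundaryProduct Λ q (F ξ) (F η) := by
  obtain ⟨δ', h'⟩ := hφ.exists_fourPoint hΓ hΛ h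
  obtain ⟨L, C, hL, hLC⟩ := hφ.gromovProduct_bounds hΓ hΛ h
  refine ⟨|L * (T + 2 * δ + Λ.dist (φ p) q + C) + 2 * δ'|, abs_nonneg _, fun ξ η hlt => ?_⟩
  obtain ⟨u, hu⟩ := exists_convergesTo_of_mk hΓ ξ
  obtain ⟨v, hv⟩ := exists_convergesTo_of_mk hΓ η
  obtain ⟨N₁, h1⟩ := eventually_le_of_lt_boundaryProduct hΓ h' hu hv hlt
  have h2 := le_boundaryProduct hΛ h (hF ξ _ hu) (hF η _ hv) (p := q) (t := T + 2 * δ) fun N => by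
    refine ⟨max N N₁, le_max_left _ _, max N N₁, le_max_left _ _, ?_⟩
    have e1 := h1 _ (le_max_right N N₁) _ (le_max_right N N₁)
    have e2 := (hLC p (u.toFun (max N N₁)) (v.toFun (max N N₁))).1
    have e3 := gromovProduct_le_add_dist_base hΛ (φ p) q (φ (u.toFun (max N N₁)))
      (φ (v.toFun (max N N₁)))
    have e4 : T + 2 * δ + Λ.dist (φ p) q + C ≤
        gromovProduct Γ p (u.toFun (max N N₁)) (v.toFun (max N N₁)) / L := by
      rw [le_div_iff₀' (by linarith)]
      linarith [le_abs_self (L * (T + 2 * δ + Λ.dist (φ p) q + C) + 2 * δ')]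
    simp only [Function.comp_apply]
    linarith
  simpa using h2

/-- Points are close in a visual metric exactly when their product is large, and F sends large
products to large ones. -/
theorem IsQuasiIsometricEmbedding.continuous_boundaryMap (hΓ : Γ.Connected) (hΛ : Λ.Connected)
    {δ : ℝ} (h : FourPoint Λ δ) (hφ : IsQuasiIsometricEmbedding Γ Λ φ)
    {F : Boundary Γ → Boundary Λ}
    (hF : ∀ ξ u, ConvergesTo Γ u ξ → ConvergesTo Λ (φ ∘ u) (F ξ))
    [d₁ : MetricSpace (Boundary Γ)] (hd₁ : IsVisualMetric Γ d₁)
    [dV : MetricSpace (Boundary Λ)] (hdV : IsVisualMetric Λ dV) : Continuous F := by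
  obtain ⟨p, a, k₁, k₂, ha, hk₁, hk₂, hd⟩ := hd₁
  obtain ⟨q, b, l₁, l₂, hb, hl₁, hl₂, hd'⟩ := hdV
  refine Metric.continuous_iff.2 fun ξ ε hε => ?_
  obtain ⟨n, hn⟩ := exists_pow_lt_of_lt_one (div_pos hε hl₂) (inv_lt_one_of_one_lt₀ hb)
  obtain ⟨T, hT, hbd⟩ := hφ.le_boundaryProduct_image hΓ hΛ h hF p q n
  refine ⟨k₁ * a ^ (-T), mul_pos hk₁ (Real.rpow_pos_of_pos (by linarith) _), fun η hη => ?_⟩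
  rw [dist_comm] at hη ⊢
  have h1 := lt_of_mul_lt_mul_left ((hd ξ η).1.trans_lt hη) hk₁.le
  have h2 := powNeg_le_rpow hb (hbd ξ η (ofReal_lt_of_powNeg_lt ha hT h1))
  rw [Real.rpow_neg (by linarith), Real.rpow_natCast, ← inv_pow] at h2
  calc dist (F ξ) (F η) ≤ l₂ * powNeg b (boundaryProduct Λ q (F ξ) (F η)) := (hd' _ _).2
    _ < ε := by
      rw [← lt_div_iff₀' hl₂]
      exact h2.trans_lt hn

/-- The boundary map is weakly quasisymmetric. -/
theorem IsQuasiIsometricEmbedding.dist_boundaryMap_le (hΓ : Γ.Connected) (hΛ : Λ.Connected)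
    {δ : ℝ} (h : FourPoint Λ δ) (hφ : IsQuasiIsometricEmbedding Γ Λ φ)
    {F : Boundary Γ → Boundary Λ}
    (hF : ∀ ξ u, ConvergesTo Γ u ξ → ConvergesTo Λ (φ ∘ u) (F ξ))
    [d₁ : MetricSpace (Boundary Γ)] (hd₁ : IsVisualMetric Γ d₁)
    [dV : MetricSpace (Boundary Λ)] (hdV : IsVisualMetric Λ dV) (K : ℝ) :
    ∃ H : ℝ, ∀ ξ η ζ : Boundary Γ, ξ ≠ ζ → dist ξ η ≤ K * dist ξ ζ →
      dist (F ξ) (F η) ≤ H * dist (F ξ) (F ζ) := by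
  obtain ⟨p, a, k₁, k₂, ha, hk₁, hk₂, hd⟩ := hd₁
  obtain ⟨q, b, l₁, l₂, hb, hl₁, hl₂, hd'⟩ := hdV
  -- `K` may be nonpositive; the maximum with 1 makes the logarithm usable.
  have hM : 0 < max K 1 * k₂ / k₁ := by positivity
  obtain ⟨C, hC, hbd⟩ := hφ.boundaryProduct_order hΓ hΛ h hF p q (Real.logb a (max K 1 * k₂ / k₁))
  refine ⟨l₂ * (b ^ C / l₁), fun ξ η ζ hne hle => ?_⟩
  have hfin : boundaryProduct Γ p ξ ζ ≠ ∞ := by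
    intro htop
    have h1 := (hd ξ ζ).2
    rw [htop, powNeg_top, mul_zero] at h1
    exact (dist_pos.2 hne).not_ge h1
  have h1 : k₁ * powNeg a (boundaryProduct Γ p ξ η) ≤
      max K 1 * (k₂ * powNeg a (boundaryProduct Γ p ξ ζ)) :=
    calc _ ≤ dist ξ η := (hd ξ η).1
      _ ≤ K * dist ξ ζ := hle
      _ ≤ max K 1 * dist ξ ζ := by gcongr; exact le_max_left _ _
      _ ≤ _ := by gcongr; exact (hd ξ ζ).2
  have h2 : powNeg a (boundaryProduct Γ p ξ η) ≤
      max K 1 * k₂ / k₁ * powNeg a (boundaryProduct Γ p ξ ζ) := by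
    rw [div_mul_eq_mul_div, le_div_iff₀' hk₁, mul_assoc]
    exact h1
  have h3 := powNeg_le_mul_powNeg hb hC (hbd ξ η ζ hfin (ofReal_sub_logb_le ha hM hfin h2))
  have h4 : powNeg b (boundaryProduct Λ q (F ξ) (F ζ)) ≤ dist (F ξ) (F ζ) / l₁ := by
    rw [le_div_iff₀' hl₁]
    exact (hd' _ _).1
  have hbC : 0 < b ^ C := Real.rpow_pos_of_pos (by linarith) _
  calc dist (F ξ) (F η) ≤ l₂ * powNeg b (boundaryProduct Λ q (F ξ) (F η)) := (hd' _ _).2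
    _ ≤ l₂ * (b ^ C * (dist (F ξ) (F ζ) / l₁)) := by gcongr; exact h3.trans (by gcongr)
    _ = _ := by ring

theorem IsQuasiIsometricEmbedding.linearlyConnected_limitSet (hΓ : Γ.Connected)
    (hΛ : Λ.Connected) {δ : ℝ} (h : FourPoint Λ δ) (hφ : IsQuasiIsometricEmbedding Γ Λ φ)
    (hfΓ : ∀ (p : V) (n : ℕ), {x | Γ.dist p x ≤ n}.Finite)
    (hfΛ : ∀ (p : W) (n : ℕ), {x | Λ.dist p x ≤ n}.Finite)
    [d₁ : MetricSpace (Boundary Γ)] (hd₁ : IsVisualMetric Γ d₁)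
    (hlin : LinearlyConnected (Boundary Γ))
    [dV : MetricSpace (Boundary Λ)] (hdV : IsVisualMetric Λ dV) :
    LinearlyConnected (limitSet Λ (Set.range φ)) := by
  obtain ⟨F, hF, hrange⟩ := hφ.exists_boundaryMap hΓ hΛ h hfΓ hfΛ
  obtain ⟨K, hK⟩ := hlin
  obtain ⟨H, hH⟩ := hφ.dist_boundaryMap_le hΓ hΛ h hF hd₁ hdV K
  have hcont := hφ.continuous_boundaryMap hΓ hΛ h hF hd₁ hdV
  rw [← hrange]
  refine ⟨2 * H, ?_⟩
  rintro ⟨_, ξ, rfl⟩ ⟨_, ζ, rfl⟩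
  -- Weak quasisymmetry needs distinct points, so this case takes the constant path.
  by_cases hne : ξ = ζ
  · subst hne
    exact ⟨Path.refl _, by simp [Path.refl_range]⟩
  obtain ⟨γ, hγ⟩ := hK ξ ζ
  have hFc : Continuous (Set.rangeFactorization F) := hcont.subtype_mk _
  refine ⟨γ.map hFc, ?_⟩
  have hbd : Bornology.IsBounded (Set.range γ) := (isCompact_range γ.continuous).isBounded
  have hγd : ∀ t, dist (F ξ) (F (γ t)) ≤ H * dist (F ξ) (F ζ) := by
    intro t
    refine hH ξ (γ t) ζ hne (le_trans ?_ hγ)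
    exact Metric.dist_le_diam_of_mem hbd ⟨0, γ.source⟩ ⟨t, rfl⟩
  refine Metric.diam_le_of_forall_dist_le ?_ ?_
  -- The sign of `H` is not known; nonnegativity of the bound is read off from the estimate itself.
  · have := dist_nonneg.trans (hγd 0)
    change 0 ≤ 2 * H * dist (F ξ) (F ζ)
    linarith
  · rintro _ ⟨s, rfl⟩ _ ⟨t, rfl⟩
    change dist (F (γ s)) (F (γ t)) ≤ 2 * H * dist (F ξ) (F ζ)
    linarith [hγd s, hγd t, dist_triangle_left (F (γ s)) (F (γ t)) (F ξ)]

end BoundaryMap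
end HypGraph

/-! ### Distances in graphs under maps of vertices -/

section GraphDistance

variable {V W : Type*} {Γ : SimpleGraph V} {Λ : SimpleGraph W}

/-- Extended distances are used because coset graphs may be disconnected, where the natural-number
distance would be 0. -/
theorem SimpleGraph.edist_le_mul_walk_length {φ : V → W} {N : ℕ}
    (h : ∀ u v, Γ.Adj u v → Λ.edist (φ u) (φ v) ≤ N) {u v : V} (w : Γ.Walk u v) :
    Λ.edist (φ u) (φ v) ≤ (N * w.length : ℕ) := by
  induction w with
  | nil => simp
  | @cons a b c hab p ih =>
    refine (SimpleGraph.edist_triangle (v := φ b)).trans ((add_le_add (h _ _ hab) ih).trans ?_)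
    rw [SimpleGraph.Walk.length_cons]
    norm_cast
    exact (by ring : N + N * p.length = N * (p.length + 1)).le

theorem SimpleGraph.edist_le_mul_of_edist_le {φ : V → W} {N m : ℕ}
    (h : ∀ u v, Γ.Adj u v → Λ.edist (φ u) (φ v) ≤ N) {u v : V} (hm : Γ.edist u v ≤ m) :
    Λ.edist (φ u) (φ v) ≤ (N * m : ℕ) := by
  obtain ⟨w, hw⟩ := SimpleGraph.exists_walk_of_edist_ne_top
    (ne_top_of_le_ne_top (ENat.natCast_ne_top m) hm)
  refine (SimpleGraph.edist_le_mul_walk_length h w).trans ?_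
  rw [← hw, Nat.cast_le] at hm
  exact_mod_cast Nat.mul_le_mul_left N hm

/-- A map contracting distances up to `m` to at most one contracts distances up to `N * m` to at
most `N`. -/
theorem SimpleGraph.edist_le_of_edist_le_mul {φ : V → W} {m : ℕ}
    (h : ∀ u v, Γ.edist u v ≤ m → Λ.edist (φ u) (φ v) ≤ 1) (N : ℕ) :
    ∀ u v, Γ.edist u v ≤ (N * m : ℕ) → Λ.edist (φ u) (φ v) ≤ N := by
  induction N with
  | zero =>
    intro u v huv
    obtain rfl : u = v := by simpa using huv
    simp
  | succ N ih =>
    intro u v huv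
    obtain ⟨w, hw⟩ := SimpleGraph.exists_walk_of_edist_ne_top
      (ne_top_of_le_ne_top (ENat.natCast_ne_top _) huv)
    rw [← hw, Nat.cast_le, Nat.succ_mul] at huv
    have h1 : Γ.edist u (w.getVert m) ≤ m :=
      (SimpleGraph.edist_le (w.take m)).trans (by
        rw [SimpleGraph.Walk.take_length]
        exact_mod_cast min_le_left _ _)
    have h2 : Γ.edist (w.getVert m) v ≤ (N * m : ℕ) :=
      (SimpleGraph.edist_le (w.drop m)).trans (by
        rw [SimpleGraph.Walk.drop_length]
        exact_mod_cast (by omega : w.length - m ≤ N * m))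
    refine (SimpleGraph.edist_triangle (v := φ (w.getVert m))).trans
      ((add_le_add (h _ _ h1) (ih _ _ h2)).trans ?_)
    push_cast
    rw [add_comm]

theorem SimpleGraph.finite_edist_le (hfin : ∀ v, (Γ.neighborSet v).Finite) (n : ℕ) :
    ∀ p, {x | Γ.edist p x ≤ n}.Finite := by
  suffices h : ∀ p, {x | ∃ w : Γ.Walk p x, w.length ≤ n}.Finite by
    intro p
    refine (h p).subset fun x hx => ?_
    obtain ⟨w, hw⟩ := SimpleGraph.exists_walk_of_edist_ne_top
      (ne_top_of_le_ne_top (ENat.natCast_ne_top n) hx)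
    rw [Set.mem_ofPred_eq, ← hw, Nat.cast_le] at hx
    exact ⟨w, hx⟩
  induction n with
  | zero =>
    intro p
    refine (Set.finite_singleton p).subset ?_
    rintro x ⟨w, hw⟩
    exact (SimpleGraph.Walk.eq_of_length_eq_zero (Nat.le_zero.1 hw)).symm
  | succ n ih =>
    intro p
    refine ((Set.finite_singleton p).union ((hfin p).biUnion fun y _ => ih y)).subset ?_
    rintro x ⟨w, hw⟩
    cases w with
    | nil => exact Or.inl rfl
    | cons hab q =>
      refine Or.inr (Set.mem_biUnion hab ⟨q, ?_⟩)
      rw [SimpleGraph.Walk.length_cons] at hw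
      omega

theorem SimpleGraph.Connected.finite_dist_le (hc : Γ.Connected)
    (hfin : ∀ v, (Γ.neighborSet v).Finite) (p : V) (n : ℕ) : {x | Γ.dist p x ≤ n}.Finite := by
  refine (SimpleGraph.finite_edist_le hfin n p).subset fun x hx => ?_
  rw [Set.mem_ofPred_eq, ← (hc.preconnected _ _).coe_dist_eq_edist]
  exact_mod_cast hx

theorem SimpleGraph.Connected.dist_le_of_edist_le (hc : Γ.Connected) {u v : V} {n : ℕ}
    (h : Γ.edist u v ≤ n) : Γ.dist u v ≤ n := by
  rw [← (hc.preconnected _ _).coe_dist_eq_edist] at h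
  exact_mod_cast h

end GraphDistance

/-! ### Cayley graphs -/

section Cayley

variable {G : Type*} [Group G]

theorem finite_neighborSet_mulCayley {S : Set G} (hS : S.Finite) (g : G) :
    ((SimpleGraph.mulCayley S).neighborSet g).Finite := by
  refine ((hS.image fun s => g * s).union (hS.image fun s => g * s⁻¹)).subset fun h hh => ?_
  rw [SimpleGraph.mem_neighborSet, SimpleGraph.mulCayley_adj'] at hh
  obtain ⟨-, s, hs, rfl | rfl⟩ := hh
  · exact Or.inl ⟨s, hs, rfl⟩
  · exact Or.inr ⟨s, hs, by simp⟩

/-- Left translations are isometries, so one bound serves all `g`; the inverse case starts at `g *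
x⁻¹`. -/
theorem exists_edist_mulCayley_le_of_mem_closure {S : Set G} {x : G}
    (hx : x ∈ Subgroup.closure S) :
    ∃ n : ℕ, ∀ g, (SimpleGraph.mulCayley S).edist g (g * x) ≤ n := by
  induction hx using Subgroup.closure_induction with
  | mem s hs =>
    refine ⟨1, fun g => ?_⟩
    rw [Nat.cast_one, SimpleGraph.edist_le_one_iff_adj_or_eq, SimpleGraph.mulCayley_adj']
    by_cases h : g = g * s
    · exact Or.inr h
    · exact Or.inl ⟨h, s, hs, Or.inl rfl⟩
  | one => exact ⟨0, fun g => by simp⟩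
  | mul x y _ _ hx hy =>
    obtain ⟨m, hm⟩ := hx
    obtain ⟨n, hn⟩ := hy
    refine ⟨m + n, fun g => ?_⟩
    rw [← mul_assoc, Nat.cast_add]
    exact (SimpleGraph.edist_triangle (v := g * x)).trans (add_le_add (hm g) (hn (g * x)))
  | inv x _ hx =>
    obtain ⟨n, hn⟩ := hx
    refine ⟨n, fun g => ?_⟩
    rw [SimpleGraph.edist_comm]
    simpa using hn (g * x⁻¹)

/-- Cayley graphs with respect to a finite set `T` in the subgroup generated by `S` are
Lipschitz over those with respect to `S`. -/
theorem exists_edist_mulCayley_le_of_adj {S T : Set G} (hT : T.Finite)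
    (hTS : T ⊆ Subgroup.closure S) :
    ∃ N : ℕ, ∀ g h, (SimpleGraph.mulCayley T).Adj g h →
      (SimpleGraph.mulCayley S).edist g h ≤ N := by
  have hex : ∀ t : G, ∃ n : ℕ, t ∈ T → ∀ g, (SimpleGraph.mulCayley S).edist g (g * t) ≤ n := by
    intro t
    by_cases ht : t ∈ T
    · obtain ⟨n, hn⟩ := exists_edist_mulCayley_le_of_mem_closure (hTS ht)
      exact ⟨n, fun _ => hn⟩
    · exact ⟨0, fun h => (ht h).elim⟩
  choose n hn using hex
  refine ⟨hT.toFinset.sup n, fun g h hgh => ?_⟩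
  rw [SimpleGraph.mulCayley_adj'] at hgh
  obtain ⟨-, t, ht, hth⟩ := hgh
  have hle : (n t : ℕ∞) ≤ (hT.toFinset.sup n : ℕ) := by
    exact_mod_cast Finset.le_sup (f := n) (hT.mem_toFinset.2 ht)
  rcases hth with rfl | rfl
  · exact (hn t ht g).trans hle
  · rw [SimpleGraph.edist_comm]
    exact (hn t ht h).trans hle

end Cayley

/-! ### Cusped spaces -/

section Cusped

variable {G ι : Type*} [Group G] {P : ι → Subgroup G} {S S' : Set G}

theorem cuspedGraph_adj_of_edge {x y : CuspVertex G ι} (h : CuspEdge P S x y) :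
    (cuspedGraph P S).Adj x y := by
  refine (SimpleGraph.fromRel_adj _ _ _).2 ⟨?_, Or.inl h⟩
  cases h with
  | cayley g h hgh =>
    intro he
    injection he with he
    exact hgh.ne he
  | horizontal i g h k hne _ =>
    intro he
    injection he with _ he
    exact hne he
  | verticalBase i g => exact fun he => by cases he
  | vertical i g k =>
    intro he
    injection he with _ _ he
    omega

theorem cuspedGraph_edist_le_one_of_edge {x y : CuspVertex G ι} (h : CuspEdge P S x y) :
    (cuspedGraph P S).edist x y ≤ 1 :=
  SimpleGraph.edist_le_one_iff_adj_or_eq.2 (Or.inl (cuspedGraph_adj_of_edge h))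

/-- Horizontal neighbours lie in a ball of the locally finite coset graph. For `k = 0` the entry
with `k - 1` is the vertex itself, which is harmless. -/
theorem finite_neighborSet_cuspedGraph [Finite ι] (hS : S.Finite) (x : CuspVertex G ι) :
    ((cuspedGraph P S).neighborSet x).Finite := by
  cases x with
  | base g =>
    refine (((finite_neighborSet_mulCayley hS g).image CuspVertex.base).union
      (Set.finite_range fun i : ι => CuspVertex.horo i g 0)).subset fun y hy => ?_
    obtain ⟨-, h | h⟩ := (SimpleGraph.fromRel_adj _ _ _).1 hy
    · cases h with
      | cayley _ h hgh => exact Or.inl ⟨h, hgh, rfl⟩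
      | verticalBase i => exact Or.inr ⟨i, rfl⟩
    · cases h with
      | cayley h _ hgh => exact Or.inl ⟨h, hgh.symm, rfl⟩
  | horo i g k =>
    have hball := (SimpleGraph.finite_edist_le (Γ := cosetGraph S (P i))
      (finite_neighborSet_mulCayley (hS.inter_of_left _)) (2 ^ (k + 1)) g)
    refine ((hball.image fun h => CuspVertex.horo i h k).union
      (Set.toFinite {CuspVertex.base g, CuspVertex.horo i g (k + 1),
        CuspVertex.horo i g (k - 1)})).subset fun y hy => ?_
    obtain ⟨-, h | h⟩ := (SimpleGraph.fromRel_adj _ _ _).1 hy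
    · cases h with
      | horizontal _ _ h _ _ hle => exact Or.inl ⟨h, hle, rfl⟩
      | vertical => simp
    · cases h with
      | horizontal _ h _ _ _ hle =>
        rw [SimpleGraph.edist_comm] at hle
        exact Or.inl ⟨h, hle, rfl⟩
      | verticalBase => simp
      | vertical => simp

theorem IsCuspGeneratingSet.connected (hS : IsCuspGeneratingSet P S) :
    (cuspedGraph P S).Connected := by
  have hbase : ∀ g, (cuspedGraph P S).Reachable (.base 1) (.base g) := by
    intro g
    obtain ⟨n, hn⟩ := exists_edist_mulCayley_le_of_mem_closure (S := S) (x := g)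
      (by rw [hS.closure_eq]; trivial)
    have h1 := SimpleGraph.edist_le_mul_of_edist_le (Λ := cuspedGraph P S)
      (φ := CuspVertex.base) (N := 1) (fun u v huv => by
        simpa using cuspedGraph_edist_le_one_of_edge (.cayley u v huv)) (hn 1)
    rw [one_mul] at h1
    exact SimpleGraph.reachable_of_edist_ne_top (ne_top_of_le_ne_top (ENat.natCast_ne_top _) h1)
  have hall : ∀ x, (cuspedGraph P S).Reachable (.base 1) x := by
    rintro (g | ⟨i, g, k⟩)
    · exact hbase g
    · induction k with
      | zero => exact (hbase g).trans (cuspedGraph_adj_of_edge (.verticalBase i g)).reachable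
      | succ k ih => exact ih.trans (cuspedGraph_adj_of_edge (.vertical i g k)).reachable
  have : Nonempty (CuspVertex G ι) := ⟨.base 1⟩
  exact ⟨fun x y => (hall x).symm.trans (hall y)⟩

/-- Changing the generating set changes the distance of a cusped space by at most a factor. -/
theorem IsCuspGeneratingSet.exists_dist_le [Finite ι] (hS : IsCuspGeneratingSet P S)
    (hS' : IsCuspGeneratingSet P S') :
    ∃ N : ℕ, ∀ x y, (cuspedGraph P S).dist x y ≤ N * (cuspedGraph P S').dist x y := by
  cases nonempty_fintype ι
  obtain ⟨N₀, h0⟩ := exists_edist_mulCayley_le_of_adj (S := S) hS'.finite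
    (by rw [hS.closure_eq]; exact fun _ _ => trivial)
  have hi : ∀ i, ∃ N : ℕ, ∀ g h, (cosetGraph S' (P i)).Adj g h →
      (cosetGraph S (P i)).edist g h ≤ N := fun i =>
    exists_edist_mulCayley_le_of_adj (S := S ∩ (P i : Set G))
      (hS'.finite.inter_of_left _)
      (by rw [hS.closure_inter_eq]; exact Set.inter_subset_right)
  choose N hN using hi
  set M := max 1 (max N₀ (Finset.univ.sup N)) with hM
  have hM1 : (1 : ℕ∞) ≤ M := by exact_mod_cast le_max_left _ _
  have hedge : ∀ x y, CuspEdge P S' x y → (cuspedGraph P S).edist x y ≤ M := by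
    intro x y hxy
    cases hxy with
    | cayley g h hgh =>
      have h1 := SimpleGraph.edist_le_mul_of_edist_le (Λ := cuspedGraph P S)
        (φ := CuspVertex.base) (N := 1) (fun u v huv => by
          simpa using cuspedGraph_edist_le_one_of_edge (.cayley u v huv)) (h0 g h hgh)
      rw [one_mul] at h1
      exact h1.trans (by exact_mod_cast (le_max_left _ _).trans (le_max_right _ _))
    | horizontal i g h k hne hle =>
      -- An edge of `S'`-length at most `2 ^ (k + 1)` has `S`-length at most `N i * 2 ^ (k + 1)`. It
      -- splits into `N i` horizontal steps at the same depth, so the factor does not depend on `k`.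
      have h1 := SimpleGraph.edist_le_mul_of_edist_le (Λ := cosetGraph S (P i)) (φ := id)
        (hN i) hle
      have h2 := SimpleGraph.edist_le_of_edist_le_mul (Γ := cosetGraph S (P i))
        (Λ := cuspedGraph P S) (φ := fun v => CuspVertex.horo i v k) (m := 2 ^ (k + 1))
        (fun u v huv => by
          by_cases he : u = v
          · simp [he]
          · exact cuspedGraph_edist_le_one_of_edge (.horizontal i u v k he huv)) (N i) g h h1
      refine h2.trans ?_
      have : N i ≤ Finset.univ.sup N := Finset.le_sup (Finset.mem_univ i)
      exact_mod_cast this.trans ((le_max_right _ _).trans (le_max_right _ _))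
    | verticalBase i g => exact (cuspedGraph_edist_le_one_of_edge (.verticalBase i g)).trans hM1
    | vertical i g k => exact (cuspedGraph_edist_le_one_of_edge (.vertical i g k)).trans hM1
  refine ⟨M, fun x y => hS.connected.dist_le_of_edist_le ?_⟩
  refine SimpleGraph.edist_le_mul_of_edist_le (Γ := cuspedGraph P S') (φ := id) ?_
    (hS'.connected.preconnected x y).coe_dist_eq_edist.ge
  intro u v huv
  obtain ⟨-, h | h⟩ := (SimpleGraph.fromRel_adj _ _ _).1 huv
  · exact hedge u v h
  · rw [SimpleGraph.edist_comm]
    exact hedge v u h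

/-- Hyperbolicity is given for one generating set only; the identity on vertices is bilipschitz, and
the four point condition is pulled back along it. -/
theorem IsCuspGeneratingSet.exists_fourPoint (hS : IsCuspGeneratingSet P S)
    (hP : IsRelativelyHyperbolic P) : ∃ δ, HypGraph.FourPoint (cuspedGraph P S) δ := by
  obtain ⟨hι, S', hS', hyp⟩ := hP
  obtain ⟨δ, hδ⟩ := hyp.exists_fourPoint
  obtain ⟨M, hM⟩ := hS.exists_dist_le hS'
  obtain ⟨N, hN⟩ := hS'.exists_dist_le hS
  have hqi : HypGraph.IsQuasiIsometricEmbedding (cuspedGraph P S) (cuspedGraph P S') id := by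
    refine ⟨M + N + 1, 0, ?_, le_rfl, fun x y => ?_⟩
    · linarith [Nat.cast_nonneg (α := ℝ) M, Nat.cast_nonneg (α := ℝ) N]
    · have h1 : ((cuspedGraph P S).dist x y : ℝ) ≤ M * (cuspedGraph P S').dist x y := by
        exact_mod_cast hM x y
      have h2 : ((cuspedGraph P S').dist x y : ℝ) ≤ N * (cuspedGraph P S).dist x y := by
        exact_mod_cast hN x y
      simp only [id, sub_zero, add_zero]
      constructor
      · rw [div_le_iff₀' (by positivity)]
        refine h1.trans ?_
        gcongr
        linarith [Nat.cast_nonneg (α := ℝ) N]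
      · refine h2.trans ?_
        gcongr
        linarith [Nat.cast_nonneg (α := ℝ) M]
  exact hqi.exists_fourPoint hS.connected hyp.1 hδ

end Cusped

theorem mainTheorem3 {G : Type*} [Group G] {ι κ : Type*}
    (P : ι → Subgroup G) (hG : IsRelativelyHyperbolic P)
    (A : Subgroup G) (Q : κ → Subgroup A) (hA : IsRelativelyHyperbolic Q)
    (S : Set G) (hS : IsCuspGeneratingSet P S)
    (T : Set A) (hT : IsCuspGeneratingSet Q T)
    [d₁ : MetricSpace (HypGraph.Boundary (cuspedGraph Q T))]
    (hd₁ : HypGraph.IsVisualMetric (cuspedGraph Q T) d₁)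
    (hlin : LinearlyConnected (HypGraph.Boundary (cuspedGraph Q T)))
    [dV : MetricSpace (HypGraph.Boundary (cuspedGraph P S))]
    (hdV : HypGraph.IsVisualMetric (cuspedGraph P S) dV)
    (f : κ → ι) (hf : ∀ j, (Q j).map A.subtype ≤ P (f j))
    (hi : HypGraph.IsQuasiIsometricEmbedding (cuspedGraph Q T) (cuspedGraph P S)
      (cuspedInclusion A f)) :
    LinearlyConnected
      (HypGraph.limitSet (cuspedGraph P S) (Set.range (cuspedInclusion (ι := ι) A f))) := by
  -- Finiteness of both index families makes the cusped graphs locally finite.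
  have := hG.1
  have := hA.1
  obtain ⟨δ, hδ⟩ := hS.exists_fourPoint hG
  exact hi.linearlyConnected_limitSet hT.connected hS.connected hδ
    (hT.connected.finite_dist_le (finite_neighborSet_cuspedGraph hT.finite))
    (hS.connected.finite_dist_le (finite_neighborSet_cuspedGraph hS.finite)) hd₁ hlin hdV
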